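/- Let $b(v,w)=\sum_{a\le p}v_aw_a-\sum_{a>p}v_aw_a$ be the standard inner product of signature $(p,q)$ on $\mathbb R^{p+q}$ and let $H=SO(p,q)\subset SL(p+q,\mathbb R)$ be the group of matrices of determinant one preserving $b$. Let $M=Gr(i,\mathbb R^{p+q})$ be the Grassmannian of $i$-dimensional subspaces with its usual smooth structure, let $E\to M$ be the tautological bundle, whose fiber $E_y$ at $y\in M$ is the subspace $y$, and let $\sigma_1\in\Gamma(S^2E^*)$ be the section whose value at $y$ is the restriction of $b$ to $E_y$. For $0\le r\le p$ and $0\le s\le q$ let $\mathcal O_{(r,s)}\subset M$ be the set of all $y$ for which $\sigma_1(y)$ has signature $(r,s)$, i.e. $r$ positive and $s$ negative squares. Suppose that $r+s<i$, put $\nu:=i-r-s$, and let $x\in\mathcal O_{(r,s)}$. Then there are an open neighborhood $U$ of $x$ in $M$, such that $$N:=U\cap\mathcal O_{(r,s)}=U\cap(H\cdot x),$$ and a smooth subbundle $\tilde E\subset E|_U$ of rank $\nu$ such that 1. for each $y\in U$ the null space of $\sigma_1(y)$ is contained in $\tilde E_y\subset E_y$; 2. the section $\tilde\sigma$ of $S^2\tilde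 E^*$ over $U$ obtained by restricting $\sigma_1(y)$ to $\tilde E_y$ for each $y\in U$ is a defining section for $N$. That is, $\tilde\sigma$ is smooth, $N$ is an embedded smooth submanifold of $M$ whose codimension equals the rank $\nu(\nu+1)/2$ of $S^2\tilde E^*$, and for each $y\in N$ one has $\tilde\sigma(y)=0$ and the linear map $\nabla\tilde\sigma(y):T_yM\to S^2\tilde E_y^*$ is surjective. Here $\nabla$ is any linear connection; as $\tilde\sigma(y)=0$, the map $\nabla\tilde\sigma(y)$ does not depend on its choice and satisfies $(\nabla_\xi\tilde\sigma)(v,w)=\xi\cdot\tilde\sigma(v,w)$ at $y$ for all smooth sections $v,w$ of $\tilde E$ defined near $y$. -/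

import Mathlib

open scoped Manifold ContDiff

/-- The Grassmannian of `i`-dimensional linear subspaces of a real vector space `V`. -/
@[ext]
structure Gr (i : ℕ) (V : Type*) [AddCommGroup V] [Module ℝ V] where
  carrier : Submodule ℝ V
  finrank_carrier : Module.finrank ℝ carrier = i

namespace Gr

noncomputable section

/-! ### The smooth structure of the Grassmannian -/

section Charts

set_option linter.unusedSectionVars false

variable (i : ℕ) (V : Type*) [NormedAddCommGroup V] [NormedSpace ℝ V] [FiniteDimensional ℝ V]

/-- The model space of `Gr i V`, where `n = dim V`: linear maps `ℝ^i → ℝ^(n-i)`. -/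
abbrev Model : Type :=
  (Fin i → ℝ) →L[ℝ] (Fin (Module.finrank ℝ V - i) → ℝ)

/-- A linear frame of `V` adapted to a splitting into dimensions `i` and `n - i`. -/
abbrev SplitFrame : Type _ :=
  ((Fin i → ℝ) × (Fin (Module.finrank ℝ V - i) → ℝ)) ≃L[ℝ] V

variable {i V}

/-- The injective linear map `v ↦ g (v, A v)`. -/
def graphMap (g : SplitFrame i V) (A : Model i V) : (Fin i → ℝ) →ₗ[ℝ] V :=
  (g.toContinuousLinearMap.comp ((ContinuousLinearMap.id ℝ (Fin i → ℝ)).prod A)).toLinearMap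

theorem graphMap_apply (g : SplitFrame i V) (A : Model i V) (v : Fin i → ℝ) :
    graphMap g A v = g (v, A v) := rfl

theorem graphMap_injective (g : SplitFrame i V) (A : Model i V) :
    Function.Injective (graphMap g A) := by
  intro v w h
  rw [graphMap_apply, graphMap_apply] at h
  exact congrArg Prod.fst (g.injective h)

/-- The affine parametrization of the Grassmannian given by `g`: it sends a linear map `A` to the
image under `g` of the graph of `A`. -/
def param (g : SplitFrame i V) (A : Model i V) : Gr i V where
  carrier := LinearMap.range (graphMap g A)
  finrank_carrier := by
    rw [LinearMap.finrank_range_of_inj (graphMap_injective g A)]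
    simp

theorem param_injective (g : SplitFrame i V) : Function.Injective (param g) := by
  intro A B h
  have hr : LinearMap.range (graphMap g A) = LinearMap.range (graphMap g B) :=
    congrArg Gr.carrier h
  ext1 v
  have hv : graphMap g A v ∈ LinearMap.range (graphMap g B) := hr ▸ LinearMap.mem_range_self _ v
  obtain ⟨w, hw⟩ := hv
  rw [graphMap_apply, graphMap_apply] at hw
  have h1 := g.injective hw
  have h2 : w = v := congrArg Prod.fst h1
  have h3 : B w = A v := congrArg Prod.snd h1
  rw [← h3, h2]

/-- The affine chart of the Grassmannian given by `g`: the inverse of `param g`. -/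
def affineChart (g : SplitFrame i V) : PartialEquiv (Gr i V) (Model i V) where
  toFun := Function.invFun (param g)
  invFun := param g
  source := Set.range (param g)
  target := Set.univ
  map_source' _ _ := Set.mem_univ _
  map_target' A _ := Set.mem_range_self A
  left_inv' := by
    rintro _ ⟨A, rfl⟩
    rw [Function.leftInverse_invFun (param_injective g) A]
  right_inv' A _ := Function.leftInverse_invFun (param_injective g) A

/-- Every `W` lies at the centre of some affine chart. -/
theorem exists_param_eq (W : Gr i V) : ∃ g : SplitFrame i V, param g 0 = W := by
  obtain ⟨C, hC⟩ := W.carrier.exists_isCompl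
  have hdim := Submodule.finrank_add_eq_of_isCompl hC
  have hWd := W.finrank_carrier
  let e₁ : (Fin i → ℝ) ≃ₗ[ℝ] W.carrier := LinearEquiv.ofFinrankEq _ _ (by simp [hWd])
  let e₂ : (Fin (Module.finrank ℝ V - i) → ℝ) ≃ₗ[ℝ] C :=
    LinearEquiv.ofFinrankEq _ _ (by simp; omega)
  let e := (e₁.prodCongr e₂).trans (Submodule.prodEquivOfIsCompl W.carrier C hC)
  refine ⟨e.toContinuousLinearEquiv, ?_⟩
  have key : ∀ v, graphMap e.toContinuousLinearEquiv 0 v = (e₁ v : V) := by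
    intro v
    simp [graphMap_apply, e]
  ext x
  constructor
  · rintro ⟨v, rfl⟩
    rw [key]
    exact (e₁ v).2
  · intro hx
    refine ⟨e₁.symm ⟨x, hx⟩, ?_⟩
    rw [key]
    simp

/-- First block of a change of frames. -/
def transFst (g g' : SplitFrame i V) (A : Model i V) : (Fin i → ℝ) →L[ℝ] (Fin i → ℝ) :=
  ((ContinuousLinearMap.fst ℝ _ _).comp (g.trans g'.symm).toContinuousLinearMap).comp
    ((ContinuousLinearMap.id ℝ (Fin i → ℝ)).prod A)

/-- Second block of a change of frames. -/
def transSnd (g g' : SplitFrame i V) (A : Model i V) : Model i V :=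
  ((ContinuousLinearMap.snd ℝ _ _).comp (g.trans g'.symm).toContinuousLinearMap).comp
    ((ContinuousLinearMap.id ℝ (Fin i → ℝ)).prod A)

theorem trans_eq (g g' : SplitFrame i V) (A : Model i V) (v : Fin i → ℝ) :
    g' (transFst g g' A v, transSnd g g' A v) = g (v, A v) := by
  have : (transFst g g' A v, transSnd g g' A v) = g'.symm (g (v, A v)) := rfl
  rw [this, ContinuousLinearEquiv.apply_symm_apply]

theorem contDiff_prodId :
    ContDiff ℝ ∞ (fun A : Model i V => (ContinuousLinearMap.id ℝ (Fin i → ℝ)).prod A) := by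
  have h : (fun A : Model i V => (ContinuousLinearMap.id ℝ (Fin i → ℝ)).prod A) =
      fun A => (ContinuousLinearMap.inl ℝ _ _).comp (ContinuousLinearMap.id ℝ (Fin i → ℝ)) +
        (ContinuousLinearMap.inr ℝ _ _).comp A := by
    funext A
    ext v <;> simp
  rw [h]
  exact contDiff_const.add (contDiff_const.clm_comp contDiff_id)

theorem contDiff_transFst (g g' : SplitFrame i V) : ContDiff ℝ ∞ (transFst g g') :=
  contDiff_const.clm_comp contDiff_prodId

theorem contDiff_transSnd (g g' : SplitFrame i V) : ContDiff ℝ ∞ (transSnd g g') :=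
  contDiff_const.clm_comp contDiff_prodId

theorem param_eq_of_isUnit (g g' : SplitFrame i V) (A : Model i V)
    (e : (Fin i → ℝ) ≃L[ℝ] (Fin i → ℝ)) (he : (e : (Fin i → ℝ) →L[ℝ] _) = transFst g g' A) :
    param g' ((transSnd g g' A).comp (e.symm : (Fin i → ℝ) →L[ℝ] _)) = param g A := by
  have key : ∀ v, graphMap g' ((transSnd g g' A).comp (e.symm : (Fin i → ℝ) →L[ℝ] _)) (e v) =
      graphMap g A v := by
    intro v
    rw [graphMap_apply, graphMap_apply, ← trans_eq g g' A v, ← he]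
    simp
  ext x
  constructor
  · rintro ⟨v, rfl⟩
    refine ⟨e.symm v, ?_⟩
    rw [← key, ContinuousLinearEquiv.apply_symm_apply]
  · rintro ⟨v, rfl⟩
    exact ⟨e v, key v⟩

theorem param_mem_range_iff (g g' : SplitFrame i V) (A : Model i V) :
    param g A ∈ Set.range (param g') ↔
      transFst g g' A ∈
        Set.range ((↑) : ((Fin i → ℝ) ≃L[ℝ] (Fin i → ℝ)) → ((Fin i → ℝ) →L[ℝ] (Fin i → ℝ))) := by
  constructor
  · rintro ⟨B, hB⟩
    have hinj : Function.Injective (transFst g g' A) := by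
      rw [injective_iff_map_eq_zero]
      intro v hv
      have h1 : graphMap g A v ∈ LinearMap.range (graphMap g' B) := by
        have : LinearMap.range (graphMap g' B) = LinearMap.range (graphMap g A) :=
          congrArg Gr.carrier hB
        rw [this]
        exact LinearMap.mem_range_self _ v
      obtain ⟨w, hw⟩ := h1
      rw [graphMap_apply, graphMap_apply, ← trans_eq g g' A v, hv] at hw
      have h2 := g'.injective hw
      have hw0 : w = 0 := congrArg Prod.fst h2
      have h3 : B w = transSnd g g' A v := congrArg Prod.snd h2
      rw [hw0, map_zero] at h3
      have h4 := trans_eq g g' A v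
      rw [hv, ← h3, Prod.mk_zero_zero, map_zero] at h4
      have h5 : ((v, A v) : (Fin i → ℝ) × _) = 0 := by
        apply g.injective
        rw [← h4, map_zero]
      exact congrArg Prod.fst h5
    refine ⟨(LinearEquiv.ofInjectiveEndo (transFst g g' A).toLinearMap
      hinj).toContinuousLinearEquiv, ?_⟩
    ext1 v
    rfl
  · rintro ⟨e, he⟩
    exact ⟨_, param_eq_of_isUnit g g' A e he⟩

theorem affineChart_trans_apply (g g' : SplitFrame i V) (A : Model i V)
    (hA : A ∈ ((affineChart g).symm.trans (affineChart g')).source) :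
    ((affineChart g).symm.trans (affineChart g')) A =
      (transSnd g g' A).comp (ContinuousLinearMap.inverse (transFst g g' A)) := by
  have hA' : param g A ∈ Set.range (param g') := by
    simpa [PartialEquiv.trans_source, affineChart] using hA
  obtain ⟨e, he⟩ := (param_mem_range_iff g g' A).1 hA'
  have h := param_eq_of_isUnit g g' A e he
  change Function.invFun (param g') (param g A) = _
  rw [← h, Function.leftInverse_invFun (param_injective g'), ← he,
    ContinuousLinearMap.inverse_equiv]

theorem affineChart_trans_source (g g' : SplitFrame i V) :
    ((affineChart g).symm.trans (affineChart g')).source =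
      transFst g g' ⁻¹' Set.range
        ((↑) : ((Fin i → ℝ) ≃L[ℝ] (Fin i → ℝ)) → ((Fin i → ℝ) →L[ℝ] (Fin i → ℝ))) := by
  ext A
  rw [Set.mem_preimage, ← param_mem_range_iff]
  simp [PartialEquiv.trans_source, affineChart]

theorem contDiffOn_affineChart_trans (g g' : SplitFrame i V) :
    ContDiffOn ℝ ∞ ((affineChart g).symm.trans (affineChart g'))
      ((affineChart g).symm.trans (affineChart g')).source := by
  have h : ContDiffOn ℝ ∞ (fun A : Model i V =>
      (transSnd g g' A).comp (ContinuousLinearMap.inverse (transFst g g' A)))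
      ((affineChart g).symm.trans (affineChart g')).source := by
    intro A hA
    rw [affineChart_trans_source] at hA
    obtain ⟨e, he⟩ := hA
    have h1 : ContDiffAt ℝ ∞ (fun A => ContinuousLinearMap.inverse (transFst g g' A)) A := by
      have h2 := contDiffAt_map_inverse (𝕜 := ℝ) (n := ∞) e
      rw [he] at h2
      exact h2.comp A (contDiff_transFst g g').contDiffAt
    exact ((contDiff_transSnd g g').contDiffAt.clm_comp h1).contDiffWithinAt
  exact h.congr fun A hA => affineChart_trans_apply g g' A hA

variable (i V) in
/-- The affine charts form an atlas. -/
def core : ChartedSpaceCore (Model i V) (Gr i V) where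
  atlas := Set.range affineChart
  chartAt W := affineChart (exists_param_eq W).choose
  mem_chart_source W := ⟨0, (exists_param_eq W).choose_spec⟩
  chart_mem_atlas W := Set.mem_range_self _
  open_source := by
    rintro _ _ ⟨g, rfl⟩ ⟨g', rfl⟩
    rw [affineChart_trans_source]
    exact (ContinuousLinearEquiv.isOpen).preimage (contDiff_transFst g g').continuous
  continuousOn_toFun := by
    rintro _ _ ⟨g, rfl⟩ ⟨g', rfl⟩
    exact (contDiffOn_affineChart_trans g g').continuousOn

/-- The topology of the Grassmannian. -/
instance : TopologicalSpace (Gr i V) := (core i V).toTopologicalSpace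

instance : ChartedSpace (Model i V) (Gr i V) := (core i V).toChartedSpace

/-- The Grassmannian is a smooth manifold, of dimension `i * (n - i)` when `i ≤ n = dim V`. -/
instance : IsManifold 𝓘(ℝ, Model i V) ∞ (Gr i V) := by
  apply isManifold_of_contDiffOn
  rintro e e' he he'
  obtain ⟨_, he⟩ := Set.mem_iUnion.1 he
  obtain ⟨⟨g, rfl⟩, rfl⟩ := Set.mem_iUnion.1 he
  obtain ⟨_, he'⟩ := Set.mem_iUnion.1 he'
  obtain ⟨⟨g', rfl⟩, rfl⟩ := Set.mem_iUnion.1 he'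
  simp only [modelWithCornersSelf_coe, modelWithCornersSelf_coe_symm, Set.range_id,
    Set.inter_univ, Set.preimage_id, Function.id_comp, Function.comp_id]
  exact contDiffOn_affineChart_trans g g'

end Charts

/-! ### Submanifolds, the tautological bundle and its subbundles -/

section Bundles

variable {i : ℕ} {V : Type*} [NormedAddCommGroup V] [NormedSpace ℝ V] [FiniteDimensional ℝ V]

/-- `N` is an embedded smooth submanifold of codimension `k` of the Grassmannian: around each of its
points there is a smooth chart which maps `N` to a linear subspace of codimension `k`. -/
def IsSubmanifold (N : Set (Gr i V)) (k : ℕ) : Prop :=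
  ∀ y ∈ N, ∃ φ ∈ IsManifold.maximalAtlas 𝓘(ℝ, Model i V) ∞ (Gr i V), y ∈ φ.source ∧
    ∃ S : Submodule ℝ (Model i V), Module.finrank ℝ (Model i V ⧸ S) = k ∧
      φ '' (φ.source ∩ N) = φ.target ∩ (S : Set (Model i V))

/-- The fibre `E_y` of the tautological bundle `E` at a point `y`: the subspace `y` itself. -/
abbrev Fib (y : Gr i V) : Type _ := y.carrier

/-- Let `F_y ⊆ E_y` be a family of subspaces of the fibres of the tautological bundle, and `v` a
section of it, `v y ∈ F_y`. As `E` is a smooth subbundle of the trivial bundle with fibre `V`, the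
section `v` is smooth over the open set `O` iff it is smooth as a map to `V`. -/
def IsSmoothSectionOn (O : Set (Gr i V)) {F : ∀ y : Gr i V, Submodule ℝ (Fib y)}
    (v : ∀ y, F y) : Prop :=
  ContMDiffOn 𝓘(ℝ, Model i V) 𝓘(ℝ, V) ∞ (fun y => ((v y : Fib y) : V)) O

/-- The spaces `F_y`, `y ∈ U`, form a smooth subbundle of rank `ν` of the restriction `E|_U` of the
tautological bundle: they have local smooth frames consisting of `ν` sections. -/
def IsSmoothSubbundleOn (U : Set (Gr i V)) (F : ∀ y : Gr i V, Submodule ℝ (Fib y)) (ν : ℕ) :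
    Prop :=
  ∀ y₀ ∈ U, ∃ O ⊆ U, IsOpen O ∧ y₀ ∈ O ∧ ∃ τ : Fin ν → ∀ y, F y,
    (∀ a, IsSmoothSectionOn O (τ a)) ∧
    ∀ y ∈ O, LinearIndependent ℝ (fun a => τ a y) ∧
      Submodule.span ℝ (Set.range fun a => τ a y) = ⊤

end Bundles

/-- `S²W*`, the space of symmetric bilinear forms on `W`. -/
def SymForm (W : Type*) [AddCommGroup W] [Module ℝ W] :
    Submodule ℝ (LinearMap.BilinForm ℝ W) where
  carrier := {B | ∀ v w, B v w = B w v}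
  add_mem' hA hB v w := by simp only [LinearMap.add_apply, hA v w, hB v w]
  zero_mem' _ _ := rfl
  smul_mem' c A hA v w := by simp only [LinearMap.smul_apply, hA v w]

/-- Restriction of symmetric bilinear forms, the natural projection `S²W* → S²F*` for `F ⊆ W`. -/
def SymForm.restrict {W : Type*} [AddCommGroup W] [Module ℝ W] (B : SymForm W)
    (F : Submodule ℝ W) : SymForm F :=
  ⟨LinearMap.BilinForm.restrict B.1 F, fun v w => B.2 v w⟩

section DefiningSections

variable {i : ℕ} {V : Type*} [NormedAddCommGroup V] [NormedSpace ℝ V] [FiniteDimensional ℝ V]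

/-- Let `σ` be a section of `S²F*` over `U` that vanishes at `y`. Then for each linear connection
`∇` on `F` one has `(∇_ξ σ)(v, w) = ξ · σ(v, w)` at `y` for all local smooth sections `v`, `w` of
`F`, as the terms `σ(∇_ξ v, w)` and `σ(v, ∇_ξ w)` vanish at `y`. If `F` is a subbundle over `U`,
this describes the linear map `D = ∇σ(y) : T_y → S²F_y*` completely. -/
def IsDerivativeAtZero (U : Set (Gr i V)) {F : ∀ y : Gr i V, Submodule ℝ (Fib y)}
    (σ : ∀ y, SymForm (F y)) (y : Gr i V)
    (D : TangentSpace 𝓘(ℝ, Model i V) y →ₗ[ℝ] SymForm (F y)) : Prop :=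
  ∀ O ⊆ U, IsOpen O → y ∈ O → ∀ v w : ∀ z, F z, IsSmoothSectionOn O v → IsSmoothSectionOn O w →
    ∀ ξ : TangentSpace 𝓘(ℝ, Model i V) y,
      (D ξ).1 (v y) (w y) =
        (mfderiv 𝓘(ℝ, Model i V) 𝓘(ℝ, ℝ) (fun z => (σ z).1 (v z) (w z)) y : _ → ℝ) ξ

/-- Let `F` be a smooth subbundle of rank `ν` of `E|_U`, so that `S²F*` has rank `ν (ν + 1) / 2`.
A section `σ` of `S²F*` over the open set `U` is a defining section for the subset `N` of `U`, if
`σ` is smooth, `N` is a submanifold whose codimension is the rank of `S²F*`, and for each `y ∈ N`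
one has `σ(y) = 0` and `∇σ(y) : T_y → S²F_y*` is surjective. -/
structure IsDefiningSection (U N : Set (Gr i V)) (F : ∀ y : Gr i V, Submodule ℝ (Fib y)) (ν : ℕ)
    (σ : ∀ y, SymForm (F y)) : Prop where
  isOpen : IsOpen U
  isSmoothSubbundleOn : IsSmoothSubbundleOn U F ν
  smooth : ∀ O ⊆ U, IsOpen O → ∀ v w : ∀ z, F z, IsSmoothSectionOn O v → IsSmoothSectionOn O w →
    ContMDiffOn 𝓘(ℝ, Model i V) 𝓘(ℝ, ℝ) ∞ (fun z => (σ z).1 (v z) (w z)) O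
  subset : N ⊆ U
  isSubmanifold : IsSubmanifold N (ν * (ν + 1) / 2)
  eq_zero : ∀ y ∈ N, σ y = 0
  surjective : ∀ y ∈ N, ∃ D : TangentSpace 𝓘(ℝ, Model i V) y →ₗ[ℝ] SymForm (F y),
    IsDerivativeAtZero U σ y D ∧ Function.Surjective D

end DefiningSections

/-! ### The group `SO(p,q)` and its orbits -/

/-- The standard inner product `b` of signature `(p, q)` on `ℝ^(p+q)`. -/
def form (p q : ℕ) : LinearMap.BilinForm ℝ (Fin p ⊕ Fin q → ℝ) :=
  Matrix.toBilin' (LieAlgebra.Orthogonal.indefiniteDiagonal (Fin p) (Fin q) ℝ)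

theorem form_apply (p q : ℕ) (v w : Fin p ⊕ Fin q → ℝ) :
    form p q v w =
      ∑ a, v (Sum.inl a) * w (Sum.inl a) - ∑ a, v (Sum.inr a) * w (Sum.inr a) := by
  simp [form, Matrix.toBilin'_apply', LieAlgebra.Orthogonal.indefiniteDiagonal,
    Matrix.mulVec_diagonal, dotProduct, sub_eq_add_neg]

theorem form_mem (p q : ℕ) : form p q ∈ SymForm (Fin p ⊕ Fin q → ℝ) := fun v w => by
  simp only [form_apply, mul_comm]

/-- The subgroup `SO(p,q)` of `SL(p+q,ℝ)` of matrices that preserve `b`. -/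
def SO (p q : ℕ) : Subgroup (Matrix.SpecialLinearGroup (Fin p ⊕ Fin q) ℝ) where
  carrier := {A | ∀ v w, form p q (A.toLin' v) (A.toLin' w) = form p q v w}
  one_mem' v w := by simp
  mul_mem' {A B} hA hB v w := by
    rw [map_mul, LinearEquiv.mul_apply, LinearEquiv.mul_apply, hA, hB]
  inv_mem' {A} hA v w := by
    have h : ∀ u, A.toLin' (A⁻¹.toLin' u) = u := fun u => by
      rw [← LinearEquiv.mul_apply, ← map_mul, mul_inv_cancel, map_one, LinearEquiv.coe_one, id]
    rw [← hA, h, h]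

/-- The natural action of `SL(n,ℝ)` on the Grassmannian of `ℝ^n`. -/
instance {ι : Type*} [Fintype ι] [DecidableEq ι] (i : ℕ) :
    MulAction (Matrix.SpecialLinearGroup ι ℝ) (Gr i (ι → ℝ)) where
  smul A W := ⟨W.carrier.map (A.toLin' : (ι → ℝ) →ₗ[ℝ] (ι → ℝ)), by
    rw [LinearEquiv.finrank_map_eq, W.finrank_carrier]⟩
  one_smul W := by
    apply Gr.ext
    change W.carrier.map _ = _
    simp
  mul_smul A B W := by
    apply Gr.ext
    change W.carrier.map _ = (W.carrier.map _).map _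
    rw [← Submodule.map_comp, map_mul]
    rfl

/-- The section `σ₁` of `S²E*`: its value at `y` is the restriction of `b` to `E_y = y`. -/
def sigma1 {p q i : ℕ} (y : Gr i (Fin p ⊕ Fin q → ℝ)) : SymForm (Fib y) :=
  SymForm.restrict ⟨form p q, form_mem p q⟩ y.carrier

/-- `𝒪_(r,s)`: the set of all subspaces to which `b` restricts with signature `(r, s)`. -/
def orbitRS (p q i r s : ℕ) : Set (Gr i (Fin p ⊕ Fin q → ℝ)) :=
  {y | sigPos (sigma1 y).1.toQuadraticMap = r ∧
    sigNeg (sigma1 y).1.toQuadraticMap = s}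

end

end Gr

/-! ### Frames adapted to the null space of the restricted form. -/

namespace Gr

noncomputable section

/-! Split `x = K ⊕ W` with `K` the null space of `b` on `x`. Since `b` is nondegenerate on the whole
space `V`, there is an isotropic `C`, dual to `K` and orthogonal to `W`; let `L` be the orthogonal
complement of `K ⊕ W ⊕ C`. Subspaces in the corresponding affine chart are graphs of linear maps `A
: K ⊕ W → C ⊕ L`. For `A` near `0` the form stays nondegenerate on the part of the graph over `W`,
and the bundle sought is the orthogonal complement of that part inside the graph. It has rank `ν`,
it contains the null space, and `b` restricted to it is a Schur complement, `schur A`, which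
vanishes as soon as the null space has dimension `ν`.

The computation that carries the proof is `schur_add_blockIncl`: adding to `A` a symmetric form `T`
on `K`, seen as a map `K → C`, adds exactly `2T` to `schur A`. Hence `schur` is affine in these
directions. Its derivative is onto the symmetric forms, its zero set is a graph over the kernel of
`symBlock` (the symmetric part of the block `K → C`), and an explicit diffeomorphism, `straighten`,
flattens this zero set.

It remains to identify the zeros near `x` with the orbit. In the chart, the derivative at `0` of `M
↦ exp(skewPart M) • x` reaches all of `ker symBlock` (`blockSnd_skewPart_lowerMatrix`), so by the
surjective form of the inverse function theorem every `A` near `0` has the same projection to `ker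
symBlock` as some point of the orbit (`exists_slope_nhds`). If `schur A = 0`, both points lie on the
same graph over `ker symBlock` and therefore agree (`eq_of_proj_eq`). So locally zeros of `schur`
lie in the orbit, the orbit lies in `𝒪_(r,s)` because the group preserves `b`, and `𝒪_(r,s)` lies in
the zeros because the signature fixes the nullity. This closes the circle without Witt's theorem. -/

/-- A linear frame of `V` adapted to a symmetric bilinear form `b` and to an `i`-dimensional
subspace, the image of the first factor, on which `b` has a null space of dimension `ν`. -/
structure AdaptedFrame {V : Type*} [NormedAddCommGroup V] [NormedSpace ℝ V]
    (b : LinearMap.BilinForm ℝ V) (i ν : ℕ) (W L : Type*) [NormedAddCommGroup W] [NormedSpace ℝ W]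
    [NormedAddCommGroup L] [NormedSpace ℝ L] where
  frame : SplitFrame i V
  fstEquiv : (Fin i → ℝ) ≃L[ℝ] (Fin ν → ℝ) × W
  sndEquiv : (Fin (Module.finrank ℝ V - i) → ℝ) ≃L[ℝ] (Fin ν → ℝ) × L
  formW : LinearMap.BilinForm ℝ W
  formL : LinearMap.BilinForm ℝ L
  formW_nondeg : ∀ w, (∀ w', formW w w' = 0) → w = 0
  formL_nondeg : ∀ l, (∀ l', formL l' l = 0) → l = 0
  form_frame : ∀ u a u' a', b (frame (u, a)) (frame (u', a')) =
    (fstEquiv u).1 ⬝ᵥ (sndEquiv a').1 + (fstEquiv u').1 ⬝ᵥ (sndEquiv a).1 +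
      formW (fstEquiv u).2 (fstEquiv u').2 + formL (sndEquiv a).2 (sndEquiv a').2

/-- Given a parametrization of a subspace that splits off the null space of the restriction of `b`,
there is an isotropic subspace dual to the null space and orthogonal to its complement. -/
theorem exists_isotropic_dual {V : Type*} [AddCommGroup V] [Module ℝ V] [FiniteDimensional ℝ V]
    {b : LinearMap.BilinForm ℝ V} (hb : b.Nondegenerate) (hsymm : ∀ v w, b v w = b w v)
    {ν : ℕ} {W : Type*} [AddCommGroup W] [Module ℝ W] (X : Submodule ℝ V)
    (e : ((Fin ν → ℝ) × W) ≃ₗ[ℝ] X) (he : ∀ k, ∀ v : X, b (e (k, 0)) v = 0) :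
    ∃ c : (Fin ν → ℝ) →ₗ[ℝ] V, (∀ k w k', b (e (k, w)) (c k') = k ⬝ᵥ k') ∧
      ∀ k k', b (c k) (c k') = 0 := by
  have h1 : ∀ j : Fin ν, ∃ v : V, ∀ k w, b (e (k, w)) v = k j := by
    intro j
    let φ : X →ₗ[ℝ] ℝ :=
      ((LinearMap.proj j).comp (LinearMap.fst ℝ (Fin ν → ℝ) W)).comp e.symm.toLinearMap
    -- A coordinate functional on `X`, extended to `V`, is represented by a vector because `b` is
    -- nondegenerate on `V`.
    obtain ⟨ψ, hψ⟩ := LinearMap.exists_extend φ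
    refine ⟨(b.toDual hb).symm ψ, fun k w => ?_⟩
    rw [hsymm, LinearMap.BilinForm.apply_toDual_symm_apply]
    have := LinearMap.congr_fun hψ (e (k, w))
    simpa [φ] using this
  choose v hv using h1
  let c₀ : (Fin ν → ℝ) →ₗ[ℝ] V := Fintype.linearCombination ℝ v
  have hc₀ : ∀ k, c₀ k = ∑ j, k j • v j := fun k => rfl
  have h2 : ∀ k w k', b (e (k, w)) (c₀ k') = k ⬝ᵥ k' := by
    intro k w k'
    rw [hc₀, map_sum, dotProduct]
    refine Finset.sum_congr rfl fun j _ => ?_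
    rw [map_smul, hv, smul_eq_mul, mul_comm]
  let z : (Fin ν → ℝ) →ₗ[ℝ] (Fin ν → ℝ) := LinearMap.pi fun j => (b.flip (v j)).comp c₀
  have hz : ∀ k k', z k ⬝ᵥ k' = b (c₀ k) (c₀ k') := by
    intro k k'
    rw [hc₀ k', map_sum, dotProduct]
    refine Finset.sum_congr rfl fun j _ => ?_
    rw [map_smul, smul_eq_mul, mul_comm]
    rfl
  let km : (Fin ν → ℝ) →ₗ[ℝ] V := X.subtype.comp (e.toLinearMap.comp (LinearMap.inl ℝ _ _))
  have hkm : ∀ k, km k = e (k, 0) := fun k => rfl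
  -- Subtracting null vectors of `X` does not affect the pairing with `X`. Each of the two mixed
  -- terms of `b (c k) (c k')` removes half of `b (c₀ k) (c₀ k')`, whence the factor `1 / 2`.
  refine ⟨c₀ - (1 / 2 : ℝ) • km.comp z, fun k w k' => ?_, fun k k' => ?_⟩
  · simp only [LinearMap.sub_apply, LinearMap.smul_apply, LinearMap.comp_apply, map_sub, map_smul,
      h2, hkm]
    rw [hsymm _ (e (z k', 0) : V), he]
    simp
  · simp only [LinearMap.sub_apply, LinearMap.smul_apply, LinearMap.comp_apply, map_sub, map_smul,
      h2, hkm, he]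
    rw [hsymm (c₀ k) (e (z k', 0)), h2, hz, hz, hsymm (c₀ k')]
    simp only [smul_eq_mul]
    ring

/-- The form is nondegenerate on `K ⊕ W ⊕ C`: `K` and `C` are in duality, and `W` complements the
whole null space of the restriction. So the orthogonal complement of this sum is a true complement,
and it serves as `L`. -/
theorem exists_adaptedFrame {V : Type*} [NormedAddCommGroup V] [NormedSpace ℝ V]
    [FiniteDimensional ℝ V]
    {b : LinearMap.BilinForm ℝ V} (hb : b.Nondegenerate) (hsymm : ∀ v w, b v w = b w v)
    {i : ℕ} (ν : ℕ) (x : Gr i V)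
    (hx : Module.finrank ℝ (LinearMap.ker (b.restrict x.carrier)) = ν) :
    ∃ (m l : ℕ) (𝓕 : AdaptedFrame b i ν (Fin m → ℝ) (Fin l → ℝ)), param 𝓕.frame 0 = x := by
  obtain ⟨Wc, hWc⟩ := (LinearMap.ker (b.restrict x.carrier)).exists_isCompl
  have hdim := Submodule.finrank_add_eq_of_isCompl hWc
  rw [hx, x.finrank_carrier] at hdim
  obtain ⟨m, hm⟩ : ∃ m, Module.finrank ℝ Wc = m := ⟨_, rfl⟩
  rw [hm] at hdim
  let eK : (Fin ν → ℝ) ≃ₗ[ℝ] LinearMap.ker (b.restrict x.carrier) :=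
    LinearEquiv.ofFinrankEq _ _ (by simp [hx])
  let eW : (Fin m → ℝ) ≃ₗ[ℝ] Wc := LinearEquiv.ofFinrankEq _ _ (by simp [hm])
  let e := (eK.prodCongr eW).trans (Submodule.prodEquivOfIsCompl _ Wc hWc)
  have he : ∀ k w, (e (k, w) : x.carrier) = eK k + eW w := fun k w => rfl
  have hker : ∀ k, ∀ v : x.carrier, b (e (k, 0)) v = 0 := by
    intro k v
    have := LinearMap.congr_fun (LinearMap.mem_ker.1 (eK k).2) v
    rw [he, map_zero, Submodule.coe_zero, add_zero]
    exact this
  obtain ⟨c, hc1, hc2⟩ := exists_isotropic_dual hb hsymm x.carrier e hker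
  let wm : (Fin m → ℝ) →ₗ[ℝ] V :=
    x.carrier.subtype.comp (e.toLinearMap.comp (LinearMap.inr ℝ _ _))
  have hwm : ∀ w, wm w = e (0, w) := fun w => rfl
  have hsplit : ∀ k w, (e (k, w) : V) = e (k, 0) + wm w := by
    intro k w
    rw [hwm, ← Submodule.coe_add, ← map_add]
    simp
  have hee : ∀ k w k' w', b (e (k, w)) (e (k', w')) = b (wm w) (wm w') := by
    intro k w k' w'
    rw [hsplit k w, map_add, LinearMap.add_apply, hker, zero_add, hsplit k' w', map_add,
      hsymm _ (e (k', 0) : V), hwm w, hker, zero_add]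
  have hD : ∀ w, (∀ w', b (wm w) (wm w') = 0) → w = 0 := by
    intro w hw
    have h1 : e (0, w) ∈ LinearMap.ker (b.restrict x.carrier) := by
      rw [LinearMap.mem_ker]
      ext v
      obtain ⟨⟨k', w'⟩, rfl⟩ := e.surjective v
      exact (hee 0 w k' w').trans (hw w')
    have h2 : e (0, w) = eW w := by simp [he]
    rw [h2] at h1
    have h3 := Submodule.disjoint_def.1 hWc.disjoint _ h1 (eW w).2
    simpa using h3
  let T : ((Fin ν → ℝ) × (Fin m → ℝ)) × (Fin ν → ℝ) →ₗ[ℝ] V :=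
    LinearMap.coprod (x.carrier.subtype.comp e.toLinearMap) c
  have hT : ∀ k w k', T ((k, w), k') = e (k, w) + c k' := fun k w k' => rfl
  have hTT : ∀ k₁ w₁ c₁ k₂ w₂ c₂, b (T ((k₁, w₁), c₁)) (T ((k₂, w₂), c₂)) =
      k₁ ⬝ᵥ c₂ + k₂ ⬝ᵥ c₁ + b (wm w₁) (wm w₂) := by
    intro k₁ w₁ c₁ k₂ w₂ c₂
    rw [hT, hT, map_add, map_add, LinearMap.add_apply, LinearMap.add_apply, hee, hc1, hc2,
      hsymm (c c₁), hc1]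
    ring
  -- The component in `W` is detected by pairing with `W`, the one in `K` by pairing with `C`, and
  -- the one in `C` by pairing with `K`.
  have hTnd : ∀ t, (∀ t', b (T t) (T t') = 0) → t = 0 := by
    rintro ⟨⟨k, w⟩, k'⟩ ht
    have h1 : w = 0 := hD w fun w' => by simpa [hTT] using ht ((0, w'), 0)
    have h2 : k = 0 := by
      ext j
      simpa [hTT, h1] using ht ((0, 0), Pi.single j 1)
    have h3 : k' = 0 := by
      ext j
      simpa [hTT, h1] using ht ((Pi.single j 1, 0), 0)
    rw [h1, h2, h3]; rfl
  have hTinj : Function.Injective T := by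
    rw [injective_iff_map_eq_zero]
    intro t ht
    exact hTnd t fun t' => by simp [ht]
  have hrefl : b.IsRefl := fun v w h => by rw [hsymm]; exact h
  have hcompl : IsCompl (LinearMap.range T) (b.orthogonal (LinearMap.range T)) := by
    apply LinearMap.BilinForm.isCompl_orthogonal_of_restrict_nondegenerate hrefl
    have hleft : ∀ v : LinearMap.range T,
        (∀ v', b.restrict (LinearMap.range T) v v' = 0) → v = 0 := by
      rintro ⟨_, t, rfl⟩ h
      have : t = 0 := hTnd t fun t' => h ⟨T t', t', rfl⟩
      simp [this]
    refine ⟨hleft, fun v h => hleft v fun v' => ?_⟩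
    rw [← h v']
    exact hsymm _ _
  let Lc := b.orthogonal (LinearMap.range T)
  obtain ⟨l, hl⟩ : ∃ l, Module.finrank ℝ Lc = l := ⟨_, rfl⟩
  have hdim2 := Submodule.finrank_add_eq_of_isCompl hcompl
  rw [LinearMap.finrank_range_of_inj hTinj, hl] at hdim2
  simp only [Module.finrank_prod, Module.finrank_fin_fun] at hdim2
  let eL : (Fin l → ℝ) ≃ₗ[ℝ] Lc := LinearEquiv.ofFinrankEq _ _ (by simp [hl])
  have horth : ∀ t l, b (T t) (eL l) = 0 := fun t l =>
    (LinearMap.BilinForm.mem_orthogonal_iff.1 (eL l).2) (T t) ⟨t, rfl⟩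
  let G : ((((Fin ν → ℝ) × (Fin m → ℝ)) × (Fin ν → ℝ)) × (Fin l → ℝ)) ≃ₗ[ℝ] V :=
    ((LinearEquiv.ofInjective T hTinj).prodCongr eL).trans
      (Submodule.prodEquivOfIsCompl _ _ hcompl)
  have hG : ∀ t l, G (t, l) = T t + eL l := fun t l => rfl
  let e₁ : (Fin i → ℝ) ≃ₗ[ℝ] (Fin ν → ℝ) × (Fin m → ℝ) :=
    LinearEquiv.ofFinrankEq _ _ (by simp [hdim])
  let e₂ : (Fin (Module.finrank ℝ V - i) → ℝ) ≃ₗ[ℝ] (Fin ν → ℝ) × (Fin l → ℝ) :=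
    LinearEquiv.ofFinrankEq _ _ (by simp; omega)
  let g := (((e₁.prodCongr e₂).trans (LinearEquiv.prodAssoc ℝ _ _ _).symm).trans
    G).toContinuousLinearEquiv
  have hg : ∀ u a, g (u, a) = T (e₁ u, (e₂ a).1) + eL (e₂ a).2 := fun u a => rfl
  have hL : ∀ l, (∀ l', b (eL l') (eL l) = 0) → l = 0 := by
    intro l₀ h
    have h1 : (eL l₀ : V) = 0 := by
      apply hb.2
      intro v
      obtain ⟨⟨t, l'⟩, rfl⟩ := G.surjective v
      rw [hG, map_add, LinearMap.add_apply, horth, h, add_zero]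
    simpa using h1
  refine ⟨m, l, ⟨g, e₁.toContinuousLinearEquiv, e₂.toContinuousLinearEquiv,
    b.compl₁₂ wm wm, b.compl₁₂ (Lc.subtype.comp eL.toLinearMap) (Lc.subtype.comp eL.toLinearMap),
    hD, hL, ?_⟩, ?_⟩
  · intro u a u' a'
    rw [hg, hg, map_add, map_add, LinearMap.add_apply, LinearMap.add_apply, horth,
      hsymm (eL (e₂ a).2) (T _), horth, hTT]
    simp
  · ext v
    have key : ∀ u, graphMap g 0 u = (e (e₁ u) : V) := by
      intro u
      rw [graphMap_apply, hg]
      simp [T]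
    constructor
    · rintro ⟨u, rfl⟩
      change graphMap g 0 u ∈ _
      rw [key]
      exact (e (e₁ u)).2
    · intro hv
      refine ⟨e₁.symm (e.symm ⟨v, hv⟩), ?_⟩
      change graphMap g 0 _ = _
      rw [key]
      simp

end

end Gr

/-! ### Gram blocks of a graph and their Schur complement. -/

namespace Gr

noncomputable section

set_option linter.unusedSectionVars false

/-- A bilinear form on a finite-dimensional space as a continuous bilinear map. -/
def clmForm {V : Type*} [NormedAddCommGroup V] [NormedSpace ℝ V] [FiniteDimensional ℝ V]
    (b : LinearMap.BilinForm ℝ V) : V →L[ℝ] V →L[ℝ] ℝ :=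
  ((LinearMap.toContinuousLinearMap : (V →ₗ[ℝ] ℝ) ≃ₗ[ℝ] (V →L[ℝ] ℝ)).toLinearMap.comp
    b).toContinuousLinearMap

@[simp]
theorem clmForm_apply {V : Type*} [NormedAddCommGroup V] [NormedSpace ℝ V] [FiniteDimensional ℝ V]
    (b : LinearMap.BilinForm ℝ V) (v w : V) : clmForm b v w = b v w := rfl

theorem _root_.contDiff_clm_flip {E F H : Type*} [NormedAddCommGroup E] [NormedSpace ℝ E]
    [NormedAddCommGroup F] [NormedSpace ℝ F] [NormedAddCommGroup H] [NormedSpace ℝ H]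
    {n : WithTop ℕ∞} : ContDiff ℝ n (fun T : E →L[ℝ] F →L[ℝ] H => T.flip) :=
  LinearIsometryEquiv.contDiff (𝕜 := ℝ) (E := E →L[ℝ] F →L[ℝ] H) (F := F →L[ℝ] E →L[ℝ] H)
    (ContinuousLinearMap.flipₗᵢ ℝ E F H)

/-- The pull back of a continuous bilinear map depends smoothly on the maps along which it is
pulled back. -/
theorem _root_.ContDiffAt.clm_bilinearComp {X E F E' F' H : Type*}
    [NormedAddCommGroup X] [NormedSpace ℝ X] [NormedAddCommGroup E] [NormedSpace ℝ E]
    [NormedAddCommGroup F] [NormedSpace ℝ F] [NormedAddCommGroup E'] [NormedSpace ℝ E']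
    [NormedAddCommGroup F'] [NormedSpace ℝ F'] [NormedAddCommGroup H] [NormedSpace ℝ H]
    {n : WithTop ℕ∞} (B : E →L[ℝ] F →L[ℝ] H) {f : X → E' →L[ℝ] E} {g : X → F' →L[ℝ] F} {x : X}
    (hf : ContDiffAt ℝ n f x) (hg : ContDiffAt ℝ n g x) :
    ContDiffAt ℝ n (fun x => B.bilinearComp (f x) (g x)) x := by
  have h1 : ContDiffAt ℝ n (fun x => (B.comp (f x)).flip) x :=
    contDiff_clm_flip.contDiffAt.comp x (contDiffAt_const.clm_comp hf)
  exact contDiff_clm_flip.contDiffAt.comp x (h1.clm_comp hg)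

namespace AdaptedFrame

section

variable {V : Type*} [NormedAddCommGroup V] [NormedSpace ℝ V] [FiniteDimensional ℝ V]
  {b : LinearMap.BilinForm ℝ V} {i ν : ℕ} {W L : Type*} [NormedAddCommGroup W] [NormedSpace ℝ W]
  [NormedAddCommGroup L] [NormedSpace ℝ L]
  (𝓕 : AdaptedFrame b i ν W L)

/-- The inclusion `k ↦ (k, 0)` in the first factor of the frame. -/
def inclK : (Fin ν → ℝ) →L[ℝ] (Fin i → ℝ) :=
  𝓕.fstEquiv.symm.toContinuousLinearMap.comp (ContinuousLinearMap.inl ℝ _ _)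

/-- The inclusion `w ↦ (0, w)` in the first factor of the frame. -/
def inclW : W →L[ℝ] (Fin i → ℝ) :=
  𝓕.fstEquiv.symm.toContinuousLinearMap.comp (ContinuousLinearMap.inr ℝ _ _)

@[simp]
theorem fstEquiv_inclK (k : Fin ν → ℝ) : 𝓕.fstEquiv (𝓕.inclK k) = (k, 0) := by
  simp [inclK]

@[simp]
theorem fstEquiv_inclW (w : W) : 𝓕.fstEquiv (𝓕.inclW w) = (0, w) := by
  simp [inclW]

theorem inclK_add_inclW (u : Fin i → ℝ) :
    𝓕.inclK (𝓕.fstEquiv u).1 + 𝓕.inclW (𝓕.fstEquiv u).2 = u := by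
  apply 𝓕.fstEquiv.injective
  simp

/-- The continuous linear version of `graphMap`. -/
def pos (A : Model i V) : (Fin i → ℝ) →L[ℝ] V :=
  𝓕.frame.toContinuousLinearMap.comp ((ContinuousLinearMap.id ℝ (Fin i → ℝ)).prod A)

theorem pos_apply (A : Model i V) (u : Fin i → ℝ) : 𝓕.pos A u = 𝓕.frame (u, A u) := rfl

theorem contDiff_pos : ContDiff ℝ ∞ 𝓕.pos :=
  contDiff_const.clm_comp contDiff_prodId

/-- The block of the Gram form of the graph of `A` that belongs to `W`. -/
def gramW (A : Model i V) : W →L[ℝ] W →L[ℝ] ℝ :=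
  (clmForm b).bilinearComp ((𝓕.pos A).comp 𝓕.inclW) ((𝓕.pos A).comp 𝓕.inclW)

/-- The mixed block of the Gram form of the graph of `A`. -/
def gramKW (A : Model i V) : (Fin ν → ℝ) →L[ℝ] W →L[ℝ] ℝ :=
  (clmForm b).bilinearComp ((𝓕.pos A).comp 𝓕.inclK) ((𝓕.pos A).comp 𝓕.inclW)

theorem gramW_apply (A : Model i V) (w w' : W) :
    𝓕.gramW A w w' = b (𝓕.pos A (𝓕.inclW w)) (𝓕.pos A (𝓕.inclW w')) := rfl

theorem gramKW_apply (A : Model i V) (k : Fin ν → ℝ) (w : W) :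
    𝓕.gramKW A k w = b (𝓕.pos A (𝓕.inclK k)) (𝓕.pos A (𝓕.inclW w)) := rfl

/-- The set of all `A` such that `b` is nondegenerate on the graph of `A` over `W`. -/
def dom : Set (Model i V) :=
  𝓕.gramW ⁻¹' Set.range ((↑) : (W ≃L[ℝ] (W →L[ℝ] ℝ)) → (W →L[ℝ] (W →L[ℝ] ℝ)))

/-- The component in `W` of the orthogonal projection that makes `K` orthogonal to `W`. -/
def corr (A : Model i V) : (Fin ν → ℝ) →L[ℝ] W :=
  -(ContinuousLinearMap.inverse (𝓕.gramW A)).comp (𝓕.gramKW A)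

/-- A parametrization of the orthogonal complement of the graph of `A` over `W` inside the graph
of `A`. -/
def perp (A : Model i V) : (Fin ν → ℝ) →L[ℝ] (Fin i → ℝ) :=
  𝓕.inclK + 𝓕.inclW.comp (𝓕.corr A)

/-- The restriction of `b` to the orthogonal complement, parametrized by `perp`. -/
def schur (A : Model i V) : (Fin ν → ℝ) →L[ℝ] (Fin ν → ℝ) →L[ℝ] ℝ :=
  (clmForm b).bilinearComp ((𝓕.pos A).comp (𝓕.perp A)) ((𝓕.pos A).comp (𝓕.perp A))

theorem schur_apply (A : Model i V) (k k' : Fin ν → ℝ) :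
    𝓕.schur A k k' = b (𝓕.pos A (𝓕.perp A k)) (𝓕.pos A (𝓕.perp A k')) := rfl

theorem perp_apply (A : Model i V) (k : Fin ν → ℝ) :
    𝓕.perp A k = 𝓕.inclK k + 𝓕.inclW (𝓕.corr A k) := rfl

@[simp]
theorem fstEquiv_perp (A : Model i V) (k : Fin ν → ℝ) :
    𝓕.fstEquiv (𝓕.perp A k) = (k, 𝓕.corr A k) := by
  simp [perp_apply]

theorem contDiff_gramW : ContDiff ℝ ∞ 𝓕.gramW :=
  contDiff_iff_contDiffAt.2 fun _ =>
    ContDiffAt.clm_bilinearComp _ (𝓕.contDiff_pos.contDiffAt.clm_comp contDiffAt_const)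
      (𝓕.contDiff_pos.contDiffAt.clm_comp contDiffAt_const)

theorem contDiff_gramKW : ContDiff ℝ ∞ 𝓕.gramKW :=
  contDiff_iff_contDiffAt.2 fun _ =>
    ContDiffAt.clm_bilinearComp _ (𝓕.contDiff_pos.contDiffAt.clm_comp contDiffAt_const)
      (𝓕.contDiff_pos.contDiffAt.clm_comp contDiffAt_const)

theorem schur_symm (hsymm : ∀ v w, b v w = b w v) (A : Model i V) (k k' : Fin ν → ℝ) :
    𝓕.schur A k k' = 𝓕.schur A k' k := hsymm _ _

theorem schur_flip (hsymm : ∀ v w, b v w = b w v) (A : Model i V) :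
    (𝓕.schur A).flip = 𝓕.schur A := by
  ext k k'
  exact hsymm _ _

variable [FiniteDimensional ℝ W]

theorem isOpen_dom : IsOpen 𝓕.dom :=
  (ContinuousLinearEquiv.isOpen).preimage 𝓕.contDiff_gramW.continuous

theorem contDiffAt_corr {A : Model i V} (hA : A ∈ 𝓕.dom) : ContDiffAt ℝ ∞ 𝓕.corr A := by
  obtain ⟨e, he⟩ := hA
  have h1 : ContDiffAt ℝ ∞ (fun A => ContinuousLinearMap.inverse (𝓕.gramW A)) A := by
    have h2 := contDiffAt_map_inverse (𝕜 := ℝ) (n := ∞) e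
    rw [he] at h2
    exact h2.comp A 𝓕.contDiff_gramW.contDiffAt
  exact (h1.clm_comp 𝓕.contDiff_gramKW.contDiffAt).neg

theorem contDiffAt_perp {A : Model i V} (hA : A ∈ 𝓕.dom) : ContDiffAt ℝ ∞ 𝓕.perp A :=
  contDiffAt_const.add (contDiffAt_const.clm_comp (𝓕.contDiffAt_corr hA))

theorem contDiffAt_pos_comp_perp {A : Model i V} (hA : A ∈ 𝓕.dom) :
    ContDiffAt ℝ ∞ (fun A => (𝓕.pos A).comp (𝓕.perp A)) A :=
  𝓕.contDiff_pos.contDiffAt.clm_comp (𝓕.contDiffAt_perp hA)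

theorem contDiffAt_schur {A : Model i V} (hA : A ∈ 𝓕.dom) : ContDiffAt ℝ ∞ 𝓕.schur A :=
  ContDiffAt.clm_bilinearComp _ (𝓕.contDiffAt_pos_comp_perp hA) (𝓕.contDiffAt_pos_comp_perp hA)

theorem gramW_zero_apply (w w' : W) : 𝓕.gramW 0 w w' = 𝓕.formW w w' := by
  rw [gramW_apply, pos_apply, pos_apply, 𝓕.form_frame]
  simp

/-- At the centre of the chart the Gram block is `formW`, which is nondegenerate; an injective map
from `W` to its dual is bijective by dimension. -/
theorem zero_mem_dom : (0 : Model i V) ∈ 𝓕.dom := by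
  have hinj : Function.Injective (𝓕.gramW 0) := by
    rw [injective_iff_map_eq_zero]
    intro w hw
    apply 𝓕.formW_nondeg
    intro w'
    rw [← gramW_zero_apply, hw]
    rfl
  have hrank : Module.finrank ℝ W = Module.finrank ℝ (W →L[ℝ] ℝ) := by
    rw [← (LinearMap.toContinuousLinearMap : (W →ₗ[ℝ] ℝ) ≃ₗ[ℝ] (W →L[ℝ] ℝ)).finrank_eq]
    exact (Subspace.dual_finrank_eq).symm
  refine ⟨(LinearMap.linearEquivOfInjective (𝓕.gramW 0).toLinearMap hinj
    hrank).toContinuousLinearEquiv, ?_⟩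
  ext1 w
  rfl

/-- The image of `perp` is orthogonal to `W`. -/
theorem form_pos_perp {A : Model i V} (hA : A ∈ 𝓕.dom) (k : Fin ν → ℝ) (w : W) :
    b (𝓕.pos A (𝓕.perp A k)) (𝓕.pos A (𝓕.inclW w)) = 0 := by
  obtain ⟨e, he⟩ := hA
  have h : 𝓕.gramW A (𝓕.corr A k) = -𝓕.gramKW A k := by
    rw [corr, ← he, ContinuousLinearMap.inverse_equiv]
    simp
  rw [perp_apply, map_add, map_add, LinearMap.add_apply, ← gramKW_apply, ← gramW_apply, h]
  simp

/-- The difference of `u` and the value of `perp` with the same component in `K` lies over `W` and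
is orthogonal to the graph over `W`, so invertibility of the Gram block forces it to vanish. Thus
`perp` parametrizes the entire orthogonal complement. -/
theorem eq_perp_of_forall_form_eq_zero {A : Model i V} (hA : A ∈ 𝓕.dom) {u : Fin i → ℝ}
    (hu : ∀ w, b (𝓕.pos A u) (𝓕.pos A (𝓕.inclW w)) = 0) : u = 𝓕.perp A (𝓕.fstEquiv u).1 := by
  set k := (𝓕.fstEquiv u).1
  set w₀ := (𝓕.fstEquiv u).2 - 𝓕.corr A k
  have h1 : u = 𝓕.perp A k + 𝓕.inclW w₀ := by
    rw [perp_apply, map_sub, ← 𝓕.inclK_add_inclW u]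
    simp [k]
  have h2 : 𝓕.gramW A w₀ = 0 := by
    ext w
    have := hu w
    rw [h1, map_add, map_add, LinearMap.add_apply, 𝓕.form_pos_perp hA, zero_add] at this
    exact this
  obtain ⟨e, he⟩ := hA
  have h3 : w₀ = 0 := by
    apply e.injective
    rw [map_zero, ← h2, ← he]
    rfl
  rw [h1, h3]
  simp

end

/-! ### The symmetric part of the isotropic block -/

section Block

variable {V : Type*} [NormedAddCommGroup V] [NormedSpace ℝ V] [FiniteDimensional ℝ V]
  {b : LinearMap.BilinForm ℝ V} {i ν : ℕ} {W L : Type*} [NormedAddCommGroup W] [NormedSpace ℝ W]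
  [NormedAddCommGroup L] [NormedSpace ℝ L]
  (𝓕 : AdaptedFrame b i ν W L)

/-- Bilinear forms on `ℝ^ν`, considered as maps into the isotropic complement, as elements of the
model space. -/
def blockIncl : ((Fin ν → ℝ) →L[ℝ] (Fin ν → ℝ) →L[ℝ] ℝ) →ₗ[ℝ] Model i V where
  toFun T := LinearMap.toContinuousLinearMap
    { toFun := fun u => 𝓕.sndEquiv.symm (fun j => T (𝓕.fstEquiv u).1 (Pi.single j 1), 0)
      map_add' := fun u u' => by
        rw [← map_add]
        congr 1
        ext <;> simp
      map_smul' := fun c u => by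
        rw [RingHom.id_apply, ← map_smul]
        congr 1
        ext <;> simp }
  map_add' T T' := by
    ext1 u
    apply 𝓕.sndEquiv.injective
    ext <;> simp
  map_smul' c T := by
    ext1 u
    apply 𝓕.sndEquiv.injective
    ext <;> simp

theorem sndEquiv_blockIncl (T : (Fin ν → ℝ) →L[ℝ] (Fin ν → ℝ) →L[ℝ] ℝ) (u : Fin i → ℝ) :
    𝓕.sndEquiv (𝓕.blockIncl T u) = (fun j => T (𝓕.fstEquiv u).1 (Pi.single j 1), 0) := by
  simp [blockIncl]

theorem _root_.dotProduct_apply_single {ν : ℕ} (φ : (Fin ν → ℝ) →L[ℝ] ℝ) (k : Fin ν → ℝ) :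
    (k ⬝ᵥ fun j => φ (Pi.single j 1)) = φ k := by
  conv_rhs => rw [pi_eq_sum_univ' k]
  rw [map_sum, dotProduct]
  refine Finset.sum_congr rfl fun j _ => ?_
  rw [map_smul, smul_eq_mul]

/-- The bilinear form on `ℝ^ν` given by the isotropic block of `A`. -/
def block : Model i V →ₗ[ℝ] ((Fin ν → ℝ) →L[ℝ] (Fin ν → ℝ) →L[ℝ] ℝ) where
  toFun A := clmForm (LinearMap.mk₂ ℝ (fun k k' => k' ⬝ᵥ (𝓕.sndEquiv (A (𝓕.inclK k))).1)
    (by intros; simp) (by intros; simp) (by intros; simp) (by intros; simp))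
  map_add' A A' := by
    ext1 k; ext1 k'
    simp
  map_smul' c A := by
    ext1 k; ext1 k'
    simp

theorem block_apply (A : Model i V) (k k' : Fin ν → ℝ) :
    𝓕.block A k k' = k' ⬝ᵥ (𝓕.sndEquiv (A (𝓕.inclK k))).1 := rfl

@[simp]
theorem block_blockIncl (T : (Fin ν → ℝ) →L[ℝ] (Fin ν → ℝ) →L[ℝ] ℝ) :
    𝓕.block (𝓕.blockIncl T) = T := by
  ext1 k; ext1 k'
  rw [block_apply, sndEquiv_blockIncl, fstEquiv_inclK, dotProduct_apply_single]

/-- The symmetric part of `block`. -/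
def symBlock : Model i V →ₗ[ℝ] ((Fin ν → ℝ) →L[ℝ] (Fin ν → ℝ) →L[ℝ] ℝ) :=
  (1 / 2 : ℝ) • (𝓕.block + (ContinuousLinearMap.flipₗᵢ ℝ (Fin ν → ℝ) (Fin ν → ℝ)
    ℝ).toLinearEquiv.toLinearMap.comp 𝓕.block)

theorem symBlock_apply (A : Model i V) :
    𝓕.symBlock A = (1 / 2 : ℝ) • (𝓕.block A + (𝓕.block A).flip) := rfl

theorem symBlock_flip (A : Model i V) : (𝓕.symBlock A).flip = 𝓕.symBlock A := by
  ext1 k; ext1 k'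
  simp [symBlock_apply, add_comm]

theorem symBlock_blockIncl {T : (Fin ν → ℝ) →L[ℝ] (Fin ν → ℝ) →L[ℝ] ℝ} (hT : T.flip = T) :
    𝓕.symBlock (𝓕.blockIncl T) = T := by
  rw [symBlock_apply, block_blockIncl, hT, ← two_smul ℝ T, smul_smul]
  norm_num

theorem pos_add (A A' : Model i V) (u : Fin i → ℝ) :
    𝓕.pos (A + A') u = 𝓕.frame (u, A u + A' u) := rfl

/-- In the frame, `C` is isotropic, orthogonal to `W` and `L`, and pairs only with `K`. Moving the
graph along `C` therefore contributes only the cross terms with `K`, with nothing quadratic in `T`.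
-/
theorem form_pos_add_blockIncl (A : Model i V) (T : (Fin ν → ℝ) →L[ℝ] (Fin ν → ℝ) →L[ℝ] ℝ)
    (u u' : Fin i → ℝ) :
    b (𝓕.pos (A + 𝓕.blockIncl T) u) (𝓕.pos (A + 𝓕.blockIncl T) u') =
      b (𝓕.pos A u) (𝓕.pos A u') + T (𝓕.fstEquiv u).1 (𝓕.fstEquiv u').1 +
        T (𝓕.fstEquiv u').1 (𝓕.fstEquiv u).1 := by
  rw [pos_add, pos_add, pos_apply, pos_apply, form_frame, form_frame, map_add, map_add,
    sndEquiv_blockIncl, sndEquiv_blockIncl]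
  simp only [Prod.fst_add, Prod.snd_add, dotProduct_add, dotProduct_apply_single, add_zero]
  ring

theorem gramW_add_blockIncl (A : Model i V) (T : (Fin ν → ℝ) →L[ℝ] (Fin ν → ℝ) →L[ℝ] ℝ) :
    𝓕.gramW (A + 𝓕.blockIncl T) = 𝓕.gramW A := by
  ext1 w; ext1 w'
  simp [gramW_apply, form_pos_add_blockIncl]

theorem gramKW_add_blockIncl (A : Model i V) (T : (Fin ν → ℝ) →L[ℝ] (Fin ν → ℝ) →L[ℝ] ℝ) :
    𝓕.gramKW (A + 𝓕.blockIncl T) = 𝓕.gramKW A := by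
  ext1 w; ext1 w'
  simp [gramKW_apply, form_pos_add_blockIncl]

theorem add_blockIncl_mem_dom {A : Model i V} (hA : A ∈ 𝓕.dom)
    (T : (Fin ν → ℝ) →L[ℝ] (Fin ν → ℝ) →L[ℝ] ℝ) : A + 𝓕.blockIncl T ∈ 𝓕.dom := by
  rw [dom, Set.mem_preimage, gramW_add_blockIncl]
  exact hA

theorem perp_add_blockIncl (A : Model i V) (T : (Fin ν → ℝ) →L[ℝ] (Fin ν → ℝ) →L[ℝ] ℝ) :
    𝓕.perp (A + 𝓕.blockIncl T) = 𝓕.perp A := by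
  rw [perp, perp, corr, corr, gramW_add_blockIncl, gramKW_add_blockIncl]

/-- The Gram blocks involving `W` do not see `T`, so `perp` is unchanged. Only `T` and its transpose
are added on `K`, which for symmetric `T` makes `2T`. -/
theorem schur_add_blockIncl (A : Model i V) {T : (Fin ν → ℝ) →L[ℝ] (Fin ν → ℝ) →L[ℝ] ℝ}
    (hT : T.flip = T) : 𝓕.schur (A + 𝓕.blockIncl T) = 𝓕.schur A + (2 : ℝ) • T := by
  ext1 k; ext1 k'
  have h : T k' k = T k k' := by
    conv_rhs => rw [← hT]
    rfl
  simp only [schur_apply, perp_add_blockIncl, form_pos_add_blockIncl, fstEquiv_perp,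
    add_apply, smul_apply, smul_eq_mul, h]
  ring

/-- The projection of the model space to the kernel of `symBlock`. -/
def proj : Model i V →ₗ[ℝ] Model i V := LinearMap.id - 𝓕.blockIncl.comp 𝓕.symBlock

theorem proj_apply (A : Model i V) : 𝓕.proj A = A - 𝓕.blockIncl (𝓕.symBlock A) := rfl

theorem symBlock_proj (A : Model i V) : 𝓕.symBlock (𝓕.proj A) = 0 := by
  rw [proj_apply, map_sub, 𝓕.symBlock_blockIncl (𝓕.symBlock_flip A), sub_self]

theorem proj_add_blockIncl (A : Model i V) : 𝓕.proj A + 𝓕.blockIncl (𝓕.symBlock A) = A := by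
  rw [proj_apply, sub_add_cancel]

theorem schur_eq_schur_proj_add (A : Model i V) :
    𝓕.schur A = 𝓕.schur (𝓕.proj A) + (2 : ℝ) • 𝓕.symBlock A := by
  rw [← 𝓕.schur_add_blockIncl _ (𝓕.symBlock_flip A), proj_add_blockIncl]

/-- The zero set of `schur` is a graph over the kernel of `symBlock`. -/
theorem eq_of_proj_eq {A A' : Model i V} (hA : 𝓕.schur A = 0) (hA' : 𝓕.schur A' = 0)
    (h : 𝓕.proj A = 𝓕.proj A') : A = A' := by
  rw [schur_eq_schur_proj_add] at hA hA'
  have h1 : (2 : ℝ) • 𝓕.symBlock A = (2 : ℝ) • 𝓕.symBlock A' := by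
    exact (eq_neg_of_add_eq_zero_right hA).trans
      (h ▸ (eq_neg_of_add_eq_zero_right hA').symm)
  have h2 : 𝓕.symBlock A = 𝓕.symBlock A' := smul_right_injective _ (two_ne_zero (α := ℝ)) h1
  rw [← 𝓕.proj_add_blockIncl A, ← 𝓕.proj_add_blockIncl A', h, h2]

/-- A diffeomorphism that maps the zero set of `schur` to the kernel of `symBlock`. -/
def straighten (hsymm : ∀ v w, b v w = b w v) : PartialEquiv (Model i V) (Model i V) where
  toFun A := A + 𝓕.blockIncl ((1 / 2 : ℝ) • 𝓕.schur A - 𝓕.symBlock A)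
  invFun A := A + 𝓕.blockIncl (𝓕.symBlock A - (1 / 2 : ℝ) • 𝓕.schur A)
  source := 𝓕.dom
  target := 𝓕.dom
  map_source' A hA := 𝓕.add_blockIncl_mem_dom hA _
  map_target' A hA := 𝓕.add_blockIncl_mem_dom hA _
  left_inv' A _ := by
    have h : ((1 / 2 : ℝ) • 𝓕.schur A - 𝓕.symBlock A).flip =
        (1 / 2 : ℝ) • 𝓕.schur A - 𝓕.symBlock A := by
      change (1 / 2 : ℝ) • (𝓕.schur A).flip - (𝓕.symBlock A).flip = _
      rw [𝓕.schur_flip hsymm, symBlock_flip]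
    -- The image `A'` of `A` has `symBlock A' = ½ schur A` and `½ schur A' = schur A - symBlock A`,
    -- so the correction made by the inverse is the opposite of the first one.
    rw [𝓕.schur_add_blockIncl _ h, map_add 𝓕.symBlock, 𝓕.symBlock_blockIncl h, add_assoc,
      ← map_add, add_eq_left]
    convert map_zero 𝓕.blockIncl
    module
  right_inv' A _ := by
    have h : (𝓕.symBlock A - (1 / 2 : ℝ) • 𝓕.schur A).flip =
        𝓕.symBlock A - (1 / 2 : ℝ) • 𝓕.schur A := by
      change (𝓕.symBlock A).flip - (1 / 2 : ℝ) • (𝓕.schur A).flip = _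
      rw [𝓕.schur_flip hsymm, symBlock_flip]
    rw [𝓕.schur_add_blockIncl _ h, map_add 𝓕.symBlock, 𝓕.symBlock_blockIncl h, add_assoc,
      ← map_add, add_eq_left]
    convert map_zero 𝓕.blockIncl
    module

theorem straighten_apply (hsymm : ∀ v w, b v w = b w v) (A : Model i V) :
    𝓕.straighten hsymm A = A + 𝓕.blockIncl ((1 / 2 : ℝ) • 𝓕.schur A - 𝓕.symBlock A) := rfl

theorem symBlock_straighten (hsymm : ∀ v w, b v w = b w v) (A : Model i V) :
    𝓕.symBlock (𝓕.straighten hsymm A) = (1 / 2 : ℝ) • 𝓕.schur A := by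
  have h : ((1 / 2 : ℝ) • 𝓕.schur A - 𝓕.symBlock A).flip =
      (1 / 2 : ℝ) • 𝓕.schur A - 𝓕.symBlock A := by
    change (1 / 2 : ℝ) • (𝓕.schur A).flip - (𝓕.symBlock A).flip = _
    rw [𝓕.schur_flip hsymm, symBlock_flip]
  rw [straighten_apply, map_add, 𝓕.symBlock_blockIncl h]
  module

variable [FiniteDimensional ℝ W]

theorem contDiff_blockIncl : ContDiff ℝ ∞ 𝓕.blockIncl :=
  ContinuousLinearMap.contDiff (𝕜 := ℝ) (E := (Fin ν → ℝ) →L[ℝ] (Fin ν → ℝ) →L[ℝ] ℝ)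
    (F := Model i V) (LinearMap.toContinuousLinearMap 𝓕.blockIncl)

theorem contDiff_symBlock : ContDiff ℝ ∞ 𝓕.symBlock :=
  ContinuousLinearMap.contDiff (𝕜 := ℝ) (E := Model i V)
    (F := (Fin ν → ℝ) →L[ℝ] (Fin ν → ℝ) →L[ℝ] ℝ) (LinearMap.toContinuousLinearMap 𝓕.symBlock)

theorem contDiffOn_straighten (hsymm : ∀ v w, b v w = b w v) :
    ContDiffOn ℝ ∞ (𝓕.straighten hsymm) 𝓕.dom := by
  intro A hA
  have h1 : ContDiffAt ℝ ∞ (fun A => (1 / 2 : ℝ) • 𝓕.schur A - 𝓕.symBlock A) A :=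
    ((𝓕.contDiffAt_schur hA).const_smul _).sub 𝓕.contDiff_symBlock.contDiffAt
  have h2 : ContDiffAt ℝ ∞
      (fun A => A + 𝓕.blockIncl ((1 / 2 : ℝ) • 𝓕.schur A - 𝓕.symBlock A)) A :=
    contDiffAt_id.add (𝓕.contDiff_blockIncl.contDiffAt.comp A h1)
  exact h2.contDiffWithinAt

theorem contDiffOn_straighten_symm (hsymm : ∀ v w, b v w = b w v) :
    ContDiffOn ℝ ∞ (𝓕.straighten hsymm).symm 𝓕.dom := by
  intro A hA
  have h1 : ContDiffAt ℝ ∞ (fun A => 𝓕.symBlock A - (1 / 2 : ℝ) • 𝓕.schur A) A :=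
    𝓕.contDiff_symBlock.contDiffAt.sub ((𝓕.contDiffAt_schur hA).const_smul _)
  have h2 : ContDiffAt ℝ ∞
      (fun A => A + 𝓕.blockIncl (𝓕.symBlock A - (1 / 2 : ℝ) • 𝓕.schur A)) A :=
    contDiffAt_id.add (𝓕.contDiff_blockIncl.contDiffAt.comp A h1)
  exact h2.contDiffWithinAt

/-- `straighten` as an open partial homeomorphism. -/
def straightenHomeomorph (hsymm : ∀ v w, b v w = b w v) :
    OpenPartialHomeomorph (Model i V) (Model i V) where
  toPartialEquiv := 𝓕.straighten hsymm
  open_source := 𝓕.isOpen_dom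
  open_target := 𝓕.isOpen_dom
  continuousOn_toFun := (𝓕.contDiffOn_straighten hsymm).continuousOn
  continuousOn_invFun := (𝓕.contDiffOn_straighten_symm hsymm).continuousOn

end Block

/-- The kernel of `symBlock` has the dimension of the space of symmetric forms as codimension. -/
theorem finrank_quotient_ker_symBlock {V : Type*} [NormedAddCommGroup V] [NormedSpace ℝ V]
    [FiniteDimensional ℝ V] {b : LinearMap.BilinForm ℝ V} {i ν : ℕ} {W L : Type*}
    [NormedAddCommGroup W] [NormedSpace ℝ W] [NormedAddCommGroup L] [NormedSpace ℝ L]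
    (𝓕 : AdaptedFrame b i ν W L) :
    Module.finrank ℝ (Model i V ⧸ LinearMap.ker 𝓕.symBlock) = ν * (ν + 1) / 2 := by
  have hsym : ∀ A k k', 𝓕.symBlock A k k' = 𝓕.symBlock A k' k := fun A k k' => by
    conv_lhs => rw [← 𝓕.symBlock_flip A]
    rfl
  -- A symmetric form is determined by its values on unordered pairs of basis vectors, and these
  -- values are arbitrary; the number of such pairs is `(ν + 1).choose 2`.
  let c : Model i V →ₗ[ℝ] (Sym2 (Fin ν) → ℝ) := LinearMap.pi fun z => Sym2.lift
    ⟨fun j l => (LinearMap.applyₗ (Pi.single l (1 : ℝ) : Fin ν → ℝ)).comp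
      (ContinuousLinearMap.coeLM ℝ |>.comp
        ((LinearMap.applyₗ (Pi.single j (1 : ℝ) : Fin ν → ℝ)).comp
          ((ContinuousLinearMap.coeLM ℝ).comp 𝓕.symBlock))), fun j l => by
      ext A
      exact hsym A _ _⟩ z
  have hc : ∀ A j l, c A s(j, l) = 𝓕.symBlock A (Pi.single j 1) (Pi.single l 1) :=
    fun A j l => rfl
  have hker : LinearMap.ker 𝓕.symBlock = LinearMap.ker c := by
    ext A
    rw [LinearMap.mem_ker, LinearMap.mem_ker]
    constructor
    · intro h
      ext z
      induction z with | _ j l => rw [hc, h]; rfl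
    · intro h
      have h' : ∀ j l, 𝓕.symBlock A (Pi.single j 1) (Pi.single l 1) = 0 := fun j l => by
        rw [← hc, h]; rfl
      ext1 k; ext1 k'
      rw [pi_eq_sum_univ' k, pi_eq_sum_univ' k']
      simp [h']
  have hsurj : Function.Surjective c := by
    intro f
    let T : (Fin ν → ℝ) →L[ℝ] (Fin ν → ℝ) →L[ℝ] ℝ :=
      clmForm (Matrix.toBilin' (Matrix.of fun j l => f s(j, l)))
    have hT : ∀ j l, T (Pi.single j 1) (Pi.single l 1) = f s(j, l) := fun j l => by
      simp [T]
    have hTf : T.flip = T := by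
      ext1 k; ext1 k'
      simp only [T, ContinuousLinearMap.flip_apply, clmForm_apply, Matrix.toBilin'_apply]
      rw [Finset.sum_comm]
      refine Finset.sum_congr rfl fun j _ => Finset.sum_congr rfl fun l _ => ?_
      simp only [Matrix.of_apply, Sym2.eq_swap (a := j)]
      ring
    refine ⟨𝓕.blockIncl T, ?_⟩
    ext z
    induction z with | _ j l => rw [hc, 𝓕.symBlock_blockIncl hTf, hT]
  rw [hker, (c.quotKerEquivOfSurjective hsurj).finrank_eq, Module.finrank_fintype_fun_eq_card,
    Sym2.card, Fintype.card_fin, Nat.choose_two_right, mul_comm, Nat.add_sub_cancel]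

end AdaptedFrame

end

end Gr

/-! ### The bundle of orthogonal complements and its defining section. -/

namespace Gr

noncomputable section

set_option linter.unusedSectionVars false

theorem mem_contDiffGroupoid_of_contDiffOn {E : Type*} [NormedAddCommGroup E] [NormedSpace ℝ E]
    {φ : OpenPartialHomeomorph E E} (h : ContDiffOn ℝ ∞ φ φ.source)
    (h' : ContDiffOn ℝ ∞ φ.symm φ.target) : φ ∈ contDiffGroupoid ∞ 𝓘(ℝ, E) := by
  rw [contDiffGroupoid, mem_groupoid_of_pregroupoid]
  simp only [contDiffPregroupoid, modelWithCornersSelf_coe, modelWithCornersSelf_coe_symm,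
    Set.range_id, Set.inter_univ, Set.preimage_id, Function.id_comp, Function.comp_id]
  exact ⟨h, h'⟩

/-- A chart in the maximal atlas followed by a local diffeomorphism of the model space. -/
theorem trans_mem_maximalAtlas {H M : Type*} [TopologicalSpace H] [TopologicalSpace M]
    [ChartedSpace H M] {G : StructureGroupoid H} {e : OpenPartialHomeomorph M H}
    {φ : OpenPartialHomeomorph H H} (he : e ∈ G.maximalAtlas M) (hφ : φ ∈ G) :
    e.trans φ ∈ G.maximalAtlas M := by
  intro e' he'
  refine ⟨?_, ?_⟩
  · rw [OpenPartialHomeomorph.trans_symm_eq_symm_trans_symm, OpenPartialHomeomorph.trans_assoc]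
    exact G.trans (G.symm hφ) (he e' he').1
  · rw [← OpenPartialHomeomorph.trans_assoc]
    exact G.trans (he e' he').2 hφ

variable {V : Type*} [NormedAddCommGroup V] [NormedSpace ℝ V] [FiniteDimensional ℝ V]
  {b : LinearMap.BilinForm ℝ V} {i ν : ℕ} {W L : Type*} [NormedAddCommGroup W] [NormedSpace ℝ W]
  [NormedAddCommGroup L] [NormedSpace ℝ L]

/-- The affine chart of the Grassmannian as an open partial homeomorphism. -/
def chart (g : SplitFrame i V) : OpenPartialHomeomorph (Gr i V) (Model i V) :=
  (core i V).openPartialHomeomorph (affineChart g) (Set.mem_range_self g)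

theorem chart_mem_atlas (g : SplitFrame i V) : chart g ∈ atlas (Model i V) (Gr i V) :=
  Set.mem_iUnion₂.2 ⟨affineChart g, Set.mem_range_self g, rfl⟩

theorem chart_mem_maximalAtlas (g : SplitFrame i V) :
    chart g ∈ IsManifold.maximalAtlas 𝓘(ℝ, Model i V) ∞ (Gr i V) :=
  IsManifold.subset_maximalAtlas (chart_mem_atlas g)

theorem param_mem_chart_source (g : SplitFrame i V) (A : Model i V) :
    param g A ∈ (chart g).source := ⟨A, rfl⟩

theorem chart_param (g : SplitFrame i V) (A : Model i V) : chart g (param g A) = A :=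
  (chart g).right_inv (Set.mem_univ A)

theorem param_chart {g : SplitFrame i V} {y : Gr i V} (hy : y ∈ (chart g).source) :
    param g (chart g y) = y :=
  (chart g).left_inv hy

theorem contMDiffAt_chart {g : SplitFrame i V} {y : Gr i V} (hy : y ∈ (chart g).source) :
    ContMDiffAt 𝓘(ℝ, Model i V) 𝓘(ℝ, Model i V) ∞ (chart g) y :=
  contMDiffAt_of_mem_maximalAtlas (chart_mem_maximalAtlas g) hy

theorem contMDiff_param (g : SplitFrame i V) :
    ContMDiff 𝓘(ℝ, Model i V) 𝓘(ℝ, Model i V) ∞ (param g) := by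
  rw [← contMDiffOn_univ]
  exact contMDiffOn_symm_of_mem_maximalAtlas (chart_mem_maximalAtlas g)

theorem mfderiv_chart_surjective {g : SplitFrame i V} {y : Gr i V} (hy : y ∈ (chart g).source) :
    Function.Surjective (mfderiv 𝓘(ℝ, Model i V) 𝓘(ℝ, Model i V) (chart g) y) := by
  have : IsManifold 𝓘(ℝ, Model i V) 1 (Gr i V) := IsManifold.of_le (n := ∞) (by norm_num)
  exact (mdifferentiable_of_mem_atlas (chart_mem_atlas g)).mfderiv_surjective hy

namespace AdaptedFrame

variable (𝓕 : AdaptedFrame b i ν W L)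

/-- The open set on which the frame gives rise to a subbundle of the tautological bundle. -/
def domGr : Set (Gr i V) := (chart 𝓕.frame).source ∩ chart 𝓕.frame ⁻¹' 𝓕.dom

theorem param_mem_domGr {A : Model i V} (hA : A ∈ 𝓕.dom) : param 𝓕.frame A ∈ 𝓕.domGr := by
  refine ⟨param_mem_chart_source _ _, ?_⟩
  rw [Set.mem_preimage, chart_param]
  exact hA

theorem isOpen_domGr [FiniteDimensional ℝ W] : IsOpen 𝓕.domGr :=
  (chart 𝓕.frame).isOpen_inter_preimage 𝓕.isOpen_dom

/-- The orthogonal complement of the graph over `W` in the fibres of the tautological bundle. -/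
def perpBundle (y : Gr i V) : Submodule ℝ (Fib y) where
  carrier := {v | ∀ w, b v (𝓕.pos (chart 𝓕.frame y) (𝓕.inclW w)) = 0}
  add_mem' hv hv' w := by
    rw [Submodule.coe_add, map_add, LinearMap.add_apply, hv w, hv' w, add_zero]
  zero_mem' w := by simp
  smul_mem' c v hv w := by
    rw [Submodule.coe_smul, map_smul, LinearMap.smul_apply, hv w, smul_zero]

theorem pos_mem (A : Model i V) (u : Fin i → ℝ) : 𝓕.pos A u ∈ (param 𝓕.frame A).carrier :=
  ⟨u, rfl⟩

theorem pos_chart_mem {y : Gr i V} (hy : y ∈ (chart 𝓕.frame).source) (u : Fin i → ℝ) :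
    𝓕.pos (chart 𝓕.frame y) u ∈ y.carrier := by
  have := 𝓕.pos_mem (chart 𝓕.frame y) u
  rwa [param_chart hy] at this

theorem exists_pos_eq {y : Gr i V} (hy : y ∈ (chart 𝓕.frame).source) (v : Fib y) :
    ∃ u, 𝓕.pos (chart 𝓕.frame y) u = v := by
  have : (v : V) ∈ (param 𝓕.frame (chart 𝓕.frame y)).carrier := by
    rw [param_chart hy]
    exact v.2
  exact this

/-- The component in `ℝ^ν` of a vector. -/
def coordK : V →L[ℝ] (Fin ν → ℝ) :=
  (ContinuousLinearMap.fst ℝ _ _).comp (𝓕.fstEquiv.toContinuousLinearMap.comp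
    ((ContinuousLinearMap.fst ℝ _ _).comp 𝓕.frame.symm.toContinuousLinearMap))

theorem coordK_pos (A : Model i V) (u : Fin i → ℝ) : 𝓕.coordK (𝓕.pos A u) = (𝓕.fstEquiv u).1 := by
  simp [coordK, pos_apply]

@[simp]
theorem coordK_pos_perp (A : Model i V) (k : Fin ν → ℝ) :
    𝓕.coordK (𝓕.pos A (𝓕.perp A k)) = k := by
  simp [coordK_pos]

variable [FiniteDimensional ℝ W]

/-- The trivialization of `perpBundle`. -/
def perpEquiv {y : Gr i V} (hy : y ∈ 𝓕.domGr) : (Fin ν → ℝ) ≃ₗ[ℝ] 𝓕.perpBundle y where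
  toFun k := ⟨⟨𝓕.pos (chart 𝓕.frame y) (𝓕.perp (chart 𝓕.frame y) k), 𝓕.pos_chart_mem hy.1 _⟩,
    𝓕.form_pos_perp hy.2 k⟩
  map_add' k k' := by
    ext
    simp
  map_smul' c k := by
    ext
    simp
  invFun v := 𝓕.coordK (v : Fib y)
  left_inv k := by simp
  right_inv v := by
    obtain ⟨u, hu⟩ := 𝓕.exists_pos_eq hy.1 (v : Fib y)
    have h : u = 𝓕.perp (chart 𝓕.frame y) (𝓕.fstEquiv u).1 :=
      𝓕.eq_perp_of_forall_form_eq_zero hy.2 fun w => by rw [hu]; exact v.2 w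
    ext
    simp only [← hu, coordK_pos, ← h]

theorem coe_perpEquiv {y : Gr i V} (hy : y ∈ 𝓕.domGr) (k : Fin ν → ℝ) :
    ((𝓕.perpEquiv hy k : Fib y) : V) =
      𝓕.pos (chart 𝓕.frame y) (𝓕.perp (chart 𝓕.frame y) k) := rfl

theorem perpEquiv_coordK {y : Gr i V} (hy : y ∈ 𝓕.domGr) (v : 𝓕.perpBundle y) :
    𝓕.pos (chart 𝓕.frame y) (𝓕.perp (chart 𝓕.frame y) (𝓕.coordK (v : Fib y))) = (v : Fib y) :=
  congrArg (fun v : 𝓕.perpBundle y => ((v : Fib y) : V)) ((𝓕.perpEquiv hy).right_inv v)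

theorem form_eq_schur {y : Gr i V} (hy : y ∈ 𝓕.domGr) (v w : 𝓕.perpBundle y) :
    b (v : Fib y) (w : Fib y) =
      𝓕.schur (chart 𝓕.frame y) (𝓕.coordK (v : Fib y)) (𝓕.coordK (w : Fib y)) := by
  rw [schur_apply, 𝓕.perpEquiv_coordK hy, 𝓕.perpEquiv_coordK hy]

theorem isSmoothSubbundleOn_perpBundle {U : Set (Gr i V)} (hU : IsOpen U) (hU' : U ⊆ 𝓕.domGr) :
    IsSmoothSubbundleOn U 𝓕.perpBundle ν := by
  classical
  intro y₀ hy₀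
  -- A section must be given at every point of the Grassmannian; the value `0` off `domGr` plays no
  -- role, as smoothness is only asked on `U`.
  refine ⟨U, le_rfl, hU, hy₀, fun a y => if hy : y ∈ 𝓕.domGr then
    𝓕.perpEquiv hy (Pi.single a 1) else 0, fun a y hy => ?_, fun y hy => ?_⟩
  · have h1 : ContMDiffAt 𝓘(ℝ, Model i V) 𝓘(ℝ, V) ∞ (fun z => 𝓕.pos (chart 𝓕.frame z)
        (𝓕.perp (chart 𝓕.frame z) (Pi.single a 1))) y := by
      have h2 : ContDiffAt ℝ ∞ (fun A => ((𝓕.pos A).comp (𝓕.perp A)) (Pi.single a 1))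
          (chart 𝓕.frame y) :=
        (𝓕.contDiffAt_pos_comp_perp (hU' hy).2).clm_apply contDiffAt_const
      exact h2.contMDiffAt.comp y (contMDiffAt_chart (hU' hy).1)
    apply h1.contMDiffWithinAt.congr
    · intro z hz
      beta_reduce
      rw [dif_pos (hU' hz), coe_perpEquiv]
    · beta_reduce
      rw [dif_pos (hU' hy), coe_perpEquiv]
  · have h : (fun a => if hy : y ∈ 𝓕.domGr then 𝓕.perpEquiv hy (Pi.single a 1) else 0) =
        (Pi.basisFun ℝ (Fin ν)).map (𝓕.perpEquiv (hU' hy)) := by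
      funext a
      rw [dif_pos (hU' hy), Module.Basis.map_apply, Pi.basisFun_apply]
    rw [h]
    exact ⟨Module.Basis.linearIndependent _, Module.Basis.span_eq _⟩

/-- The affine chart followed by `straighten` is a chart in the maximal atlas, and it carries the
zeros of `schur` to the linear subspace `ker symBlock`. -/
theorem isSubmanifold_zeros_schur (hsymm : ∀ v w, b v w = b w v) {U : Set (Gr i V)}
    (hU : IsOpen U) (hU' : U ⊆ 𝓕.domGr) :
    IsSubmanifold {y | y ∈ U ∧ 𝓕.schur (chart 𝓕.frame y) = 0} (ν * (ν + 1) / 2) := by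
  intro y hy
  set φ := ((chart 𝓕.frame).trans (𝓕.straightenHomeomorph hsymm)).restr U with hφ
  have hφs : φ.source = U := by
    rw [hφ, OpenPartialHomeomorph.restr_source' _ _ hU]
    exact Set.inter_eq_right.2 hU'
  have hker : ∀ z, φ z ∈ LinearMap.ker 𝓕.symBlock ↔ 𝓕.schur (chart 𝓕.frame z) = 0 := by
    intro z
    have : 𝓕.symBlock (φ z) = (1 / 2 : ℝ) • 𝓕.schur (chart 𝓕.frame z) :=
      𝓕.symBlock_straighten hsymm _
    rw [LinearMap.mem_ker, this]
    refine ⟨fun h => ?_, fun h => ?_⟩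
    · have h2 := congrArg ((2 : ℝ) • ·) h
      simpa [smul_smul] using h2
    · rw [h]
      ext1 k; ext1 k'
      exact mul_zero _
  refine ⟨φ, restr_mem_maximalAtlas _ (trans_mem_maximalAtlas (chart_mem_maximalAtlas _)
    (mem_contDiffGroupoid_of_contDiffOn (φ := 𝓕.straightenHomeomorph hsymm)
      (𝓕.contDiffOn_straighten hsymm)
      (𝓕.contDiffOn_straighten_symm hsymm))) hU, hφs ▸ hy.1, LinearMap.ker 𝓕.symBlock,
    𝓕.finrank_quotient_ker_symBlock, ?_⟩
  ext A
  constructor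
  · rintro ⟨z, ⟨hz, hz'⟩, rfl⟩
    exact ⟨φ.map_source hz, (hker z).2 hz'.2⟩
  · rintro ⟨hA, hA'⟩
    have h1 := φ.map_target hA
    refine ⟨φ.symm A, ⟨h1, hφs ▸ h1, (hker _).1 ?_⟩, φ.right_inv hA⟩
    rw [φ.right_inv hA]
    exact hA'

theorem hasFDerivAt_schur {A : Model i V} (hA : A ∈ 𝓕.dom) :
    HasFDerivAt 𝓕.schur (fderiv ℝ 𝓕.schur A) A :=
  ((𝓕.contDiffAt_schur hA).differentiableAt (by simp)).hasFDerivAt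

theorem hasFDerivAt_schur_apply {A : Model i V} (hA : A ∈ 𝓕.dom) (k k' : Fin ν → ℝ) :
    HasFDerivAt (fun A => 𝓕.schur A k k') (((fderiv ℝ 𝓕.schur A).flip k).flip k') A := by
  have h := ((𝓕.hasFDerivAt_schur hA).clm_apply (hasFDerivAt_const k A)).clm_apply
    (hasFDerivAt_const k' A)
  simpa using h

theorem fderiv_schur_symm (hsymm : ∀ v w, b v w = b w v) {A : Model i V} (hA : A ∈ 𝓕.dom)
    (B : Model i V) (k k' : Fin ν → ℝ) :
    fderiv ℝ 𝓕.schur A B k k' = fderiv ℝ 𝓕.schur A B k' k := by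
  have h1 := 𝓕.hasFDerivAt_schur_apply hA k k'
  have h2 := 𝓕.hasFDerivAt_schur_apply hA k' k
  have h3 : (fun A => 𝓕.schur A k k') = fun A => 𝓕.schur A k' k :=
    funext fun A => 𝓕.schur_symm hsymm A k k'
  rw [h3] at h1
  exact DFunLike.congr_fun (h1.unique h2) B

/-- Along the line through `A` in the direction `blockIncl T`, `schur` is affine with slope `2T`.
This gives surjectivity of the derivative at every point of `dom`, not just at the centre. -/
theorem fderiv_schur_blockIncl {A : Model i V} (hA : A ∈ 𝓕.dom)
    {T : (Fin ν → ℝ) →L[ℝ] (Fin ν → ℝ) →L[ℝ] ℝ} (hT : T.flip = T) :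
    fderiv ℝ 𝓕.schur A (𝓕.blockIncl T) = (2 : ℝ) • T := by
  ext1 k; ext1 k'
  have h1 := (𝓕.hasFDerivAt_schur_apply hA k k').hasLineDerivAt (𝓕.blockIncl T)
  have h2 : HasLineDerivAt ℝ (fun A => 𝓕.schur A k k') (2 * T k k') A (𝓕.blockIncl T) := by
    have h3 : ∀ t : ℝ,
        𝓕.schur (A + t • 𝓕.blockIncl T) k k' = 𝓕.schur A k k' + t * (2 * T k k') := by
      intro t
      have hT' : (t • T).flip = t • T := by
        change t • T.flip = _
        rw [hT]
      rw [← map_smul, 𝓕.schur_add_blockIncl A hT']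
      simp only [add_apply, smul_apply, smul_eq_mul]
      ring
    unfold HasLineDerivAt
    simp only [h3]
    simpa using ((hasDerivAt_id (0 : ℝ)).mul_const (2 * T k k')).const_add (𝓕.schur A k k')
  exact h1.unique h2

/-- The derivative of the restriction of `b` to `perpBundle` at a zero. -/
def derivSchur (hsymm : ∀ v w, b v w = b w v) {y : Gr i V} (hy : y ∈ 𝓕.domGr) :
    TangentSpace 𝓘(ℝ, Model i V) y →ₗ[ℝ] SymForm (𝓕.perpBundle y) where
  toFun ξ := ⟨LinearMap.mk₂ ℝ (fun v w => fderiv ℝ 𝓕.schur (chart 𝓕.frame y)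
      (mfderiv 𝓘(ℝ, Model i V) 𝓘(ℝ, Model i V) (chart 𝓕.frame) y ξ)
      (𝓕.coordK (v : Fib y)) (𝓕.coordK (w : Fib y)))
    (by intros; simp) (by intros; simp) (by intros; simp) (by intros; simp),
    fun v w => 𝓕.fderiv_schur_symm hsymm hy.2 _ _ _⟩
  map_add' ξ ξ' := by
    ext v w
    have : mfderiv 𝓘(ℝ, Model i V) 𝓘(ℝ, Model i V) (chart 𝓕.frame) y (ξ + ξ') =
      mfderiv 𝓘(ℝ, Model i V) 𝓘(ℝ, Model i V) (chart 𝓕.frame) y ξ +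
        mfderiv 𝓘(ℝ, Model i V) 𝓘(ℝ, Model i V) (chart 𝓕.frame) y ξ' := map_add _ _ _
    simp only [this]
    exact DFunLike.congr_fun (DFunLike.congr_fun (map_add (fderiv ℝ 𝓕.schur (chart 𝓕.frame y)) _ _)
      (𝓕.coordK (v : Fib y))) (𝓕.coordK (w : Fib y))
  map_smul' c ξ := by
    ext v w
    have : mfderiv 𝓘(ℝ, Model i V) 𝓘(ℝ, Model i V) (chart 𝓕.frame) y (c • ξ) =
      c • mfderiv 𝓘(ℝ, Model i V) 𝓘(ℝ, Model i V) (chart 𝓕.frame) y ξ := map_smul _ _ _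
    simp only [this]
    exact DFunLike.congr_fun (DFunLike.congr_fun (map_smul (fderiv ℝ 𝓕.schur (chart 𝓕.frame y)) c _)
      (𝓕.coordK (v : Fib y))) (𝓕.coordK (w : Fib y))

theorem derivSchur_apply (hsymm : ∀ v w, b v w = b w v) {y : Gr i V} (hy : y ∈ 𝓕.domGr)
    (ξ : TangentSpace 𝓘(ℝ, Model i V) y) (v w : 𝓕.perpBundle y) :
    (𝓕.derivSchur hsymm hy ξ).1 v w = fderiv ℝ 𝓕.schur (chart 𝓕.frame y)
      (mfderiv 𝓘(ℝ, Model i V) 𝓘(ℝ, Model i V) (chart 𝓕.frame) y ξ)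
      (𝓕.coordK (v : Fib y)) (𝓕.coordK (w : Fib y)) := rfl

theorem derivSchur_surjective (hsymm : ∀ v w, b v w = b w v) {y : Gr i V} (hy : y ∈ 𝓕.domGr) :
    Function.Surjective (𝓕.derivSchur hsymm hy) := by
  intro B
  let T : (Fin ν → ℝ) →L[ℝ] (Fin ν → ℝ) →L[ℝ] ℝ :=
    clmForm (B.1.compl₁₂ (𝓕.perpEquiv hy).toLinearMap (𝓕.perpEquiv hy).toLinearMap)
  have hT : ∀ k k', T k k' = B.1 (𝓕.perpEquiv hy k) (𝓕.perpEquiv hy k') := fun _ _ => rfl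
  have hTf : ((1 / 2 : ℝ) • T).flip = (1 / 2 : ℝ) • T := by
    ext1 k; ext1 k'
    exact congrArg ((1 / 2 : ℝ) * ·) (B.2 _ _)
  -- The factor `1 / 2` cancels the `2` in `fderiv_schur_blockIncl`.
  obtain ⟨ξ, hξ⟩ := mfderiv_chart_surjective hy.1 (𝓕.blockIncl ((1 / 2 : ℝ) • T))
  refine ⟨ξ, ?_⟩
  ext v w
  rw [derivSchur_apply, hξ]
  have h := 𝓕.fderiv_schur_blockIncl hy.2 hTf
  rw [smul_smul, show (2 : ℝ) * (1 / 2) = 1 by norm_num, one_smul] at h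
  refine (DFunLike.congr_fun (DFunLike.congr_fun h _) _).trans ?_
  rw [hT]
  exact congrArg₂ (fun v w => B.1 v w) ((𝓕.perpEquiv hy).right_inv v)
    ((𝓕.perpEquiv hy).right_inv w)

theorem differentiableAt_coordK {O : Set (Gr i V)} (hO : IsOpen O) {y : Gr i V} (hyO : y ∈ O)
    (hy : y ∈ 𝓕.domGr) {v : ∀ z, 𝓕.perpBundle z} (hv : IsSmoothSectionOn O v) :
    DifferentiableAt ℝ (fun A => 𝓕.coordK (v (param 𝓕.frame A) : Fib (param 𝓕.frame A)))
      (chart 𝓕.frame y) := by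
  have h1 : ContMDiffAt 𝓘(ℝ, Model i V) 𝓘(ℝ, V) ∞
      (fun A => ((v (param 𝓕.frame A) : Fib (param 𝓕.frame A)) : V)) (chart 𝓕.frame y) := by
    have h2 : ContMDiffAt 𝓘(ℝ, Model i V) 𝓘(ℝ, V) ∞ (fun z => ((v z : Fib z) : V))
        (param 𝓕.frame (chart 𝓕.frame y)) := by
      rw [param_chart hy.1]
      exact hv.contMDiffAt (hO.mem_nhds hyO)
    exact h2.comp (chart 𝓕.frame y) (contMDiff_param 𝓕.frame).contMDiffAt
  exact 𝓕.coordK.differentiableAt.comp _ (h1.contDiffAt.differentiableAt (by simp))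

theorem isDerivativeAtZero_derivSchur (hb : b ∈ SymForm V) {U : Set (Gr i V)}
    (hU : U ⊆ 𝓕.domGr) {y : Gr i V} (hy : y ∈ U) (hy0 : 𝓕.schur (chart 𝓕.frame y) = 0) :
    IsDerivativeAtZero U (fun z => SymForm.restrict (SymForm.restrict ⟨b, hb⟩ z.carrier)
      (𝓕.perpBundle z)) y (𝓕.derivSchur hb (hU hy)) := by
  intro O hOU hO hyO v w hv hw ξ
  have hyd := hU hy
  set A₀ := chart 𝓕.frame y with hA₀
  let kv : Model i V → (Fin ν → ℝ) :=
    fun A => 𝓕.coordK (v (param 𝓕.frame A) : Fib (param 𝓕.frame A))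
  let kw : Model i V → (Fin ν → ℝ) :=
    fun A => 𝓕.coordK (w (param 𝓕.frame A) : Fib (param 𝓕.frame A))
  have hkv : DifferentiableAt ℝ kv A₀ := 𝓕.differentiableAt_coordK hO hyO hyd hv
  have hkw : DifferentiableAt ℝ kw A₀ := 𝓕.differentiableAt_coordK hO hyO hyd hw
  have h1 : HasFDerivAt (fun A => 𝓕.schur A (kv A) (kw A)) _ A₀ :=
    ((𝓕.hasFDerivAt_schur hyd.2).clm_apply hkv.hasFDerivAt).clm_apply hkw.hasFDerivAt
  have h2 : HasMFDerivAt 𝓘(ℝ, Model i V) 𝓘(ℝ, Model i V) (chart 𝓕.frame) y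
      (mfderiv 𝓘(ℝ, Model i V) 𝓘(ℝ, Model i V) (chart 𝓕.frame) y) :=
    ((contMDiffAt_chart hyd.1).mdifferentiableAt (by simp)).hasMFDerivAt
  have h3 := h1.hasMFDerivAt.comp y h2
  have heq : (fun z => b (v z : Fib z) (w z : Fib z)) =ᶠ[nhds y]
      (fun A => 𝓕.schur A (kv A) (kw A)) ∘ chart 𝓕.frame := by
    filter_upwards [hO.mem_nhds hyO] with z hz
    have hzd := hU (hOU hz)
    -- The type of `u z` depends on `z`, so the identity `param (chart z) = z` is used by
    -- substituting a free variable.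
    have hcongr : ∀ (u : ∀ z, 𝓕.perpBundle z) (z' : Gr i V), z' = z →
        𝓕.coordK (u z' : Fib z') = 𝓕.coordK (u z : Fib z) := by
      rintro u _ rfl
      rfl
    rw [Function.comp_apply, 𝓕.form_eq_schur hzd]
    simp only [kv, kw, hcongr _ _ (param_chart hzd.1)]
  have h4 := h3.congr_of_eventuallyEq heq
  have h5 : mfderiv 𝓘(ℝ, Model i V) 𝓘(ℝ, ℝ) (fun z => b (v z : Fib z) (w z : Fib z)) y = _ :=
    h4.mfderiv
  have hcongr : ∀ u : ∀ z, 𝓕.perpBundle z,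
      𝓕.coordK (u (param 𝓕.frame A₀) : Fib (param 𝓕.frame A₀)) = 𝓕.coordK (u y : Fib y) := by
    intro u
    rw [hA₀, param_chart hyd.1]
  refine Eq.trans ?_ (DFunLike.congr_fun h5 ξ).symm
  set η := mfderiv 𝓘(ℝ, Model i V) 𝓘(ℝ, Model i V) (chart 𝓕.frame) y ξ
  change fderiv ℝ 𝓕.schur A₀ η (𝓕.coordK (v y : Fib y)) (𝓕.coordK (w y : Fib y)) =
    𝓕.schur A₀ (kv A₀) (fderiv ℝ kw A₀ η) +
      (𝓕.schur A₀ (fderiv ℝ kv A₀ η) + fderiv ℝ 𝓕.schur A₀ η (kv A₀)) (kw A₀)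
  -- The product rule has two further terms, which differentiate the sections; both contain `schur
  -- A₀` and vanish.
  rw [hy0]
  simp only [kv, kw, hcongr]
  simp

theorem contMDiffOn_form {O : Set (Gr i V)} {F : ∀ y : Gr i V, Submodule ℝ (Fib y)}
    {v w : ∀ z, F z} (hv : IsSmoothSectionOn O v) (hw : IsSmoothSectionOn O w) :
    ContMDiffOn 𝓘(ℝ, Model i V) 𝓘(ℝ, ℝ) ∞ (fun z => b (v z : Fib z) (w z : Fib z)) O := by
  have h : ContDiff ℝ ∞ (fun z : V × V => clmForm b z.1 z.2) :=
    ((clmForm b).contDiff.comp contDiff_fst).clm_apply contDiff_snd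
  exact h.contMDiff.comp_contMDiffOn (hv.prodMk_space hw)

theorem isDefiningSection_perpBundle (hb : b ∈ SymForm V) {U : Set (Gr i V)}
    (hU : IsOpen U) (hU' : U ⊆ 𝓕.domGr) :
    IsDefiningSection U {y | y ∈ U ∧ 𝓕.schur (chart 𝓕.frame y) = 0} 𝓕.perpBundle ν
      (fun z => SymForm.restrict (SymForm.restrict ⟨b, hb⟩ z.carrier) (𝓕.perpBundle z)) where
  isOpen := hU
  isSmoothSubbundleOn := 𝓕.isSmoothSubbundleOn_perpBundle hU hU'
  smooth _ _ _ _ _ hv hw := contMDiffOn_form hv hw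
  subset _ hy := hy.1
  isSubmanifold := 𝓕.isSubmanifold_zeros_schur hb hU hU'
  eq_zero y hy := by
    ext v w
    refine (𝓕.form_eq_schur (hU' hy.1) v w).trans ?_
    rw [hy.2]
    rfl
  surjective y hy := ⟨𝓕.derivSchur hb (hU' hy.1),
    𝓕.isDerivativeAtZero_derivSchur hb hU' hy.1 hy.2, 𝓕.derivSchur_surjective hb (hU' hy.1)⟩

theorem ker_le_perpBundle {y : Gr i V} (hy : y ∈ (chart 𝓕.frame).source) :
    LinearMap.ker (b.restrict y.carrier) ≤ 𝓕.perpBundle y := fun _ hv w =>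
  LinearMap.congr_fun (LinearMap.mem_ker.1 hv) ⟨_, 𝓕.pos_chart_mem hy (𝓕.inclW w)⟩

/-- The null space is contained in the fibre of `perpBundle`, and both have dimension `ν`; so they
coincide, and `b` vanishes on the fibre. -/
theorem schur_eq_zero_of_finrank_ker {y : Gr i V} (hy : y ∈ 𝓕.domGr)
    (h : Module.finrank ℝ (LinearMap.ker (b.restrict y.carrier)) = ν) :
    𝓕.schur (chart 𝓕.frame y) = 0 := by
  have h1 : LinearMap.ker (b.restrict y.carrier) = 𝓕.perpBundle y := by
    apply Submodule.eq_of_le_of_finrank_eq (𝓕.ker_le_perpBundle hy.1)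
    rw [h, ← (𝓕.perpEquiv hy).finrank_eq, Module.finrank_fin_fun]
  ext1 k; ext1 k'
  have h2 : (𝓕.perpEquiv hy k : Fib y) ∈ LinearMap.ker (b.restrict y.carrier) :=
    h1.symm.le (𝓕.perpEquiv hy k).2
  exact LinearMap.congr_fun (LinearMap.mem_ker.1 h2) (𝓕.perpEquiv hy k' : Fib y)

end AdaptedFrame

end

end Gr

/-! ### Exponentials in `SO(p,q)` and their action in an affine chart. -/

namespace Gr

noncomputable section

set_option linter.unusedSectionVars false

/-- The derivative at zero of the slope of the graph obtained by applying a one-parameter group of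
linear maps, with blocks `P` and `R`, to a coordinate subspace. -/
theorem hasStrictFDerivAt_exp_slope {𝔸 F G : Type*} [NormedRing 𝔸] [NormedAlgebra ℝ 𝔸]
    [CompleteSpace 𝔸] [NormedAddCommGroup F] [NormedSpace ℝ F] [CompleteSpace F]
    [NormedAddCommGroup G] [NormedSpace ℝ G] (P : 𝔸 →L[ℝ] (F →L[ℝ] F)) (R : 𝔸 →L[ℝ] (F →L[ℝ] G))
    (hP : P 1 = ContinuousLinearMap.id ℝ F) (hR : R 1 = 0) (s : 𝔸 →L[ℝ] 𝔸) :
    HasStrictFDerivAt (fun M => (R (NormedSpace.exp (s M))).comp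
      (ContinuousLinearMap.inverse (P (NormedSpace.exp (s M))))) (R.comp s) 0 := by
  have h1 : HasStrictFDerivAt (fun M => NormedSpace.exp (s M)) s 0 := by
    have h : HasStrictFDerivAt (NormedSpace.exp : 𝔸 → 𝔸) (1 : 𝔸 →L[ℝ] 𝔸) (s 0) := by
      rw [map_zero]
      exact hasStrictFDerivAt_exp_zero
    exact h.comp 0 s.hasStrictFDerivAt
  have h0 : NormedSpace.exp (s 0) = 1 := by rw [map_zero, NormedSpace.exp_zero]
  have h2 : HasStrictFDerivAt (fun M => R (NormedSpace.exp (s M))) (R.comp s) 0 :=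
    R.hasStrictFDerivAt.comp 0 h1
  have h3 : HasStrictFDerivAt (fun M => P (NormedSpace.exp (s M))) (P.comp s) 0 :=
    P.hasStrictFDerivAt.comp 0 h1
  have h4 : ContDiffAt ℝ 1 (ContinuousLinearMap.inverse : (F →L[ℝ] F) → (F →L[ℝ] F))
      (P (NormedSpace.exp (s 0))) := by
    rw [h0, hP]
    exact contDiffAt_map_inverse (ContinuousLinearEquiv.refl ℝ F)
  have h5 := (h4.hasStrictFDerivAt (by simp)).comp 0 h3
  have h6 := h2.clm_comp h5
  -- The term with the derivative of the inverse is multiplied by `R 1 = 0`, and in the other one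
  -- the inverse is the identity.
  refine h6.congr_fderiv ?_
  ext M v
  have h7 : ContinuousLinearMap.inverse (ContinuousLinearMap.id ℝ F) =
      ContinuousLinearMap.id ℝ F := ContinuousLinearMap.inverse_id
  simp [hP, hR, h7]

/-- The inverse function theorem for a map followed by a linear map to a subspace. -/
theorem map_nhds_eq_of_comp_surj {𝔸 E : Type*} [NormedAddCommGroup 𝔸] [NormedSpace ℝ 𝔸]
    [CompleteSpace 𝔸] [NormedAddCommGroup E] [NormedSpace ℝ E] [FiniteDimensional ℝ E]
    {S : Submodule ℝ E} (π : E →L[ℝ] S) {f : 𝔸 → E} {f' : 𝔸 →L[ℝ] E} {a : 𝔸}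
    (hf : HasStrictFDerivAt f f' a) (hsurj : ∀ z, ∃ M, π (f' M) = z) :
    Filter.map (fun M => π (f M)) (nhds a) = nhds (π (f a)) :=
  (π.hasStrictFDerivAt.comp a hf).map_nhds_eq_of_surj (LinearMap.range_eq_top.2 hsurj)

section Matrices

open Matrix

variable {p q : ℕ}

local notation "𝕄" => Matrix (Fin p ⊕ Fin q) (Fin p ⊕ Fin q) ℝ
local notation "𝕁" => LieAlgebra.Orthogonal.indefiniteDiagonal (Fin p) (Fin q) ℝ

theorem indefiniteDiagonal_mul_self : 𝕁 * 𝕁 = 1 := by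
  rw [LieAlgebra.Orthogonal.indefiniteDiagonal, diagonal_mul_diagonal, ← diagonal_one]
  congr 1
  ext (j | j) <;> simp

theorem indefiniteDiagonal_transpose : (𝕁)ᵀ = 𝕁 := by
  rw [LieAlgebra.Orthogonal.indefiniteDiagonal, diagonal_transpose]

theorem form_eq_dotProduct (v w : Fin p ⊕ Fin q → ℝ) : form p q v w = v ⬝ᵥ (𝕁 *ᵥ w) := by
  rw [form, toBilin'_apply']

theorem form_nondegenerate : (form p q).Nondegenerate := by
  have h : ∀ v, (∀ w, form p q v w = 0) → v = 0 := by
    intro v hv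
    ext j
    have := hv (𝕁 *ᵥ Pi.single j 1)
    rw [form_eq_dotProduct, mulVec_mulVec, indefiniteDiagonal_mul_self, one_mulVec] at this
    simpa using this
  exact ⟨h, fun v hv => h v fun w => (form_mem p q v w).trans (hv w)⟩

/-- The adjoint of a matrix with respect to the standard inner product. -/
theorem form_mulVec_left (M : 𝕄) (v w : Fin p ⊕ Fin q → ℝ) :
    form p q (M *ᵥ v) w = form p q v ((𝕁 * Mᵀ * 𝕁) *ᵥ w) := by
  rw [form_eq_dotProduct, form_eq_dotProduct, mulVec_mulVec, ← mul_assoc, ← mul_assoc,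
    indefiniteDiagonal_mul_self, one_mul, ← mulVec_mulVec, dotProduct_mulVec v Mᵀ,
    vecMul_transpose]

/-- Twice the projection of a matrix to the Lie algebra of `SO(p,q)`. -/
def skewPart : 𝕄 →ₗ[ℝ] 𝕄 where
  toFun M := M - 𝕁 * Mᵀ * 𝕁
  map_add' M M' := by
    rw [transpose_add, mul_add, add_mul]
    abel
  map_smul' c M := by
    rw [transpose_smul, mul_smul_comm, smul_mul_assoc, RingHom.id_apply, smul_sub]

theorem skewPart_apply (M : 𝕄) : skewPart M = M - 𝕁 * Mᵀ * 𝕁 := rfl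

theorem transpose_skewPart (M : 𝕄) : (skewPart M)ᵀ = 𝕁 * (-skewPart M) * 𝕁 := by
  have h : 𝕁 * (𝕁 * Mᵀ * 𝕁) * 𝕁 = Mᵀ := by
    rw [mul_assoc 𝕁 Mᵀ, ← mul_assoc 𝕁 𝕁, indefiniteDiagonal_mul_self, one_mul, mul_assoc,
      indefiniteDiagonal_mul_self, mul_one]
  rw [skewPart_apply, transpose_sub, transpose_mul, transpose_mul, transpose_transpose,
    indefiniteDiagonal_transpose, neg_sub, mul_sub, sub_mul, h, mul_assoc 𝕁 M]

/-- For `X = skewPart M` one has `Xᵀ = J (-X) J` with `J` its own inverse, so `exp(X)ᵀ = J exp(-X)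
J`, and `exp(-X) exp(X) = 1`. -/
theorem transpose_exp_skewPart_mul (M : 𝕄) :
    (NormedSpace.exp (skewPart M))ᵀ * 𝕁 * NormedSpace.exp (skewPart M) = 𝕁 := by
  let u : 𝕄ˣ := ⟨𝕁, 𝕁, indefiniteDiagonal_mul_self, indefiniteDiagonal_mul_self⟩
  have h : NormedSpace.exp (𝕁 * (-skewPart M) * 𝕁) = 𝕁 * NormedSpace.exp (-skewPart M) * 𝕁 :=
    Matrix.exp_units_conj u (-skewPart M)
  rw [← Matrix.exp_transpose, transpose_skewPart, h, mul_assoc _ 𝕁 𝕁, indefiniteDiagonal_mul_self,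
    mul_one, mul_assoc,
    ← Matrix.exp_add_of_commute _ _ (Commute.neg_left (Commute.refl (skewPart M))), neg_add_cancel,
    NormedSpace.exp_zero, mul_one]

theorem det_exp_skewPart (M : 𝕄) : (NormedSpace.exp (skewPart M)).det = 1 := by
  have h1 : (NormedSpace.exp (skewPart M)).det ^ 2 = 1 := by
    have h := congrArg det (transpose_exp_skewPart_mul M)
    have hJ : (𝕁).det * (𝕁).det = 1 := by
      rw [← det_mul, indefiniteDiagonal_mul_self, det_one]
    rw [det_mul, det_mul, det_transpose] at h
    have h' := congrArg (· * (𝕁).det) h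
    simp only [hJ] at h'
    linear_combination h' - (NormedSpace.exp (skewPart M)).det ^ 2 * hJ
  -- The exponential is the square of the exponential of half the matrix, which excludes determinant
  -- `-1`.
  have h2 : 0 ≤ (NormedSpace.exp (skewPart M)).det := by
    have h : NormedSpace.exp (skewPart M) =
        NormedSpace.exp ((1 / 2 : ℝ) • skewPart M) ^ 2 := by
      rw [← Matrix.exp_nsmul]
      congr 1
      module
    rw [h, det_pow]
    positivity
  nlinarith

/-- The element of `SO(p,q)` obtained from a matrix by exponentiating its skew part. -/
def expSO (M : 𝕄) : SO p q :=
  ⟨⟨NormedSpace.exp (skewPart M), det_exp_skewPart M⟩, fun v w => by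
    change form p q (NormedSpace.exp (skewPart M) *ᵥ v) (NormedSpace.exp (skewPart M) *ᵥ w) = _
    rw [form_mulVec_left, mulVec_mulVec, mul_assoc 𝕁, mul_assoc 𝕁, transpose_exp_skewPart_mul,
      indefiniteDiagonal_mul_self, one_mulVec]⟩

theorem expSO_smul_carrier {i : ℕ} (M : 𝕄) (y : Gr i (Fin p ⊕ Fin q → ℝ)) :
    (expSO M • y).carrier = y.carrier.map (NormedSpace.exp (skewPart M)).mulVecLin := rfl

/-- The first block of a matrix with respect to a frame. -/
def blockFst {i : ℕ} (g : SplitFrame i (Fin p ⊕ Fin q → ℝ)) :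
    𝕄 →ₗ[ℝ] ((Fin i → ℝ) →L[ℝ] (Fin i → ℝ)) where
  toFun M := (((ContinuousLinearMap.fst ℝ _ _).comp g.symm.toContinuousLinearMap).comp
    (LinearMap.toContinuousLinearMap M.mulVecLin)).comp
      (g.toContinuousLinearMap.comp (ContinuousLinearMap.inl ℝ _ _))
  map_add' M M' := by
    ext1 u
    simp
  map_smul' c M := by
    ext1 u
    simp

/-- The lower left block of a matrix with respect to a frame. -/
def blockSnd {i : ℕ} (g : SplitFrame i (Fin p ⊕ Fin q → ℝ)) :
    𝕄 →ₗ[ℝ] Model i (Fin p ⊕ Fin q → ℝ) where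
  toFun M := (((ContinuousLinearMap.snd ℝ _ _).comp g.symm.toContinuousLinearMap).comp
    (LinearMap.toContinuousLinearMap M.mulVecLin)).comp
      (g.toContinuousLinearMap.comp (ContinuousLinearMap.inl ℝ _ _))
  map_add' M M' := by
    ext1 u
    simp
  map_smul' c M := by
    ext1 u
    simp

theorem blockFst_apply {i : ℕ} (g : SplitFrame i (Fin p ⊕ Fin q → ℝ)) (M : 𝕄) (u : Fin i → ℝ) :
    blockFst g M u = (g.symm (M *ᵥ g (u, 0))).1 := rfl

theorem blockSnd_apply {i : ℕ} (g : SplitFrame i (Fin p ⊕ Fin q → ℝ)) (M : 𝕄) (u : Fin i → ℝ) :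
    blockSnd g M u = (g.symm (M *ᵥ g (u, 0))).2 := rfl

theorem blockFst_one {i : ℕ} (g : SplitFrame i (Fin p ⊕ Fin q → ℝ)) :
    blockFst g 1 = ContinuousLinearMap.id ℝ (Fin i → ℝ) := by
  ext1 u
  rw [blockFst_apply, one_mulVec, ContinuousLinearEquiv.symm_apply_apply]
  rfl

theorem blockSnd_one {i : ℕ} (g : SplitFrame i (Fin p ⊕ Fin q → ℝ)) : blockSnd g 1 = 0 := by
  ext1 u
  rw [blockSnd_apply, one_mulVec, ContinuousLinearEquiv.symm_apply_apply]
  rfl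

theorem frame_block {i : ℕ} (g : SplitFrame i (Fin p ⊕ Fin q → ℝ)) (M : 𝕄) (u : Fin i → ℝ) :
    g (blockFst g M u, blockSnd g M u) = M *ᵥ g (u, 0) := by
  rw [blockFst_apply, blockSnd_apply, Prod.mk.eta, ContinuousLinearEquiv.apply_symm_apply]

/-- The coordinate, in the affine chart, of the image of the centre of the chart. -/
def slope {i : ℕ} (g : SplitFrame i (Fin p ⊕ Fin q → ℝ)) (M : 𝕄) :
    Model i (Fin p ⊕ Fin q → ℝ) :=
  (blockSnd g (NormedSpace.exp (skewPart M))).comp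
    (ContinuousLinearMap.inverse (blockFst g (NormedSpace.exp (skewPart M))))

/-- The exponential sends `g (u, 0)` to `g (P u, R u)`, with `P` and `R` its first and lower left
blocks. For invertible `P` these vectors form the graph of `R P⁻¹`. -/
theorem param_slope {i : ℕ} (g : SplitFrame i (Fin p ⊕ Fin q → ℝ)) (M : 𝕄)
    (h : blockFst g (NormedSpace.exp (skewPart M)) ∈
      Set.range ((↑) : ((Fin i → ℝ) ≃L[ℝ] (Fin i → ℝ)) → ((Fin i → ℝ) →L[ℝ] (Fin i → ℝ)))) :
    param g (slope g M) = expSO M • param g 0 := by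
  obtain ⟨e, he⟩ := h
  have key : ∀ u, graphMap g (slope g M) (e u) =
      NormedSpace.exp (skewPart M) *ᵥ graphMap g 0 u := by
    intro u
    have h1 : e u = blockFst g (NormedSpace.exp (skewPart M)) u := by rw [← he]; rfl
    have h2 : slope g M (e u) = blockSnd g (NormedSpace.exp (skewPart M)) u := by
      rw [slope, ← he, ContinuousLinearMap.inverse_equiv]
      simp
    rw [graphMap_apply, h2, h1, frame_block, graphMap_apply]
    rfl
  ext v
  rw [expSO_smul_carrier]
  constructor
  · rintro ⟨u, rfl⟩
    refine ⟨graphMap g 0 (e.symm u), ⟨_, rfl⟩, ?_⟩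
    rw [mulVecLin_apply, ← key, ContinuousLinearEquiv.apply_symm_apply]
  · rintro ⟨_, ⟨u, rfl⟩, rfl⟩
    exact ⟨e u, key u⟩

end Matrices

/-! ### The tangent directions of the orbit fill the kernel of `symBlock`. -/

namespace AdaptedFrame

open Matrix

variable {p q i ν : ℕ} {W L : Type*} [NormedAddCommGroup W] [NormedSpace ℝ W]
  [NormedAddCommGroup L] [NormedSpace ℝ L] (𝓕 : AdaptedFrame (form p q) i ν W L)

local notation "𝕄" => Matrix (Fin p ⊕ Fin q) (Fin p ⊕ Fin q) ℝ
local notation "𝕁" => LieAlgebra.Orthogonal.indefiniteDiagonal (Fin p) (Fin q) ℝ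

/-- The matrix with lower left block `A` and all other blocks zero. -/
def lowerMatrix (A : Model i (Fin p ⊕ Fin q → ℝ)) : 𝕄 :=
  LinearMap.toMatrix' ((𝓕.frame.toContinuousLinearMap.comp ((ContinuousLinearMap.inr ℝ _ _).comp
    (A.comp ((ContinuousLinearMap.fst ℝ _ _).comp
      𝓕.frame.symm.toContinuousLinearMap)))) : (Fin p ⊕ Fin q → ℝ) →ₗ[ℝ] _)

theorem lowerMatrix_mulVec (A : Model i (Fin p ⊕ Fin q → ℝ)) (u a) :
    𝓕.lowerMatrix A *ᵥ 𝓕.frame (u, a) = 𝓕.frame (0, A u) := by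
  rw [lowerMatrix, LinearMap.toMatrix'_mulVec]
  simp

theorem blockSnd_lowerMatrix (A : Model i (Fin p ⊕ Fin q → ℝ)) :
    blockSnd 𝓕.frame (𝓕.lowerMatrix A) = A := by
  ext1 u
  rw [blockSnd_apply, lowerMatrix_mulVec, ContinuousLinearEquiv.symm_apply_apply]

/-- Vectors `(u, 0)` and `(0, a)` pair only through the components in `K` and `C`, so the lower left
block of the adjoint sees just the block `K → C` of `A`, transposed. -/
theorem blockSnd_adjoint_lowerMatrix (A : Model i (Fin p ⊕ Fin q → ℝ)) :
    blockSnd 𝓕.frame (𝕁 * (𝓕.lowerMatrix A)ᵀ * 𝕁) = 𝓕.blockIncl (𝓕.block A).flip := by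
  ext1 u
  rw [blockSnd_apply]
  obtain ⟨⟨u₀, a₀⟩, h⟩ := 𝓕.frame.surjective ((𝕁 * (𝓕.lowerMatrix A)ᵀ * 𝕁) *ᵥ 𝓕.frame (u, 0))
  rw [← h, ContinuousLinearEquiv.symm_apply_apply]
  -- Pairing the adjoint's value with arbitrary vectors determines it: test vectors in `K` give its
  -- component in `C`, those in `L` give its component in `L`.
  have key : ∀ u' a', (𝓕.fstEquiv u').1 ⬝ᵥ (𝓕.sndEquiv a₀).1 +
      (𝓕.fstEquiv u₀).1 ⬝ᵥ (𝓕.sndEquiv a').1 + 𝓕.formW (𝓕.fstEquiv u').2 (𝓕.fstEquiv u₀).2 +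
      𝓕.formL (𝓕.sndEquiv a').2 (𝓕.sndEquiv a₀).2 =
        (𝓕.fstEquiv u).1 ⬝ᵥ (𝓕.sndEquiv (A u')).1 := by
    intro u' a'
    rw [← 𝓕.form_frame, h, ← form_mulVec_left, lowerMatrix_mulVec, 𝓕.form_frame]
    simp
  apply 𝓕.sndEquiv.injective
  rw [sndEquiv_blockIncl]
  refine Prod.ext ?_ ?_
  · ext j
    have := key (𝓕.inclK (Pi.single j 1)) 0
    simpa [block_apply] using this
  · apply 𝓕.formL_nondeg
    intro l
    have := key 0 (𝓕.sndEquiv.symm (0, l))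
    simpa using this

/-- For `A` in the kernel of `symBlock` the block `K → C` is antisymmetric, so `skewPart` doubles
it, while the other blocks of `A` are kept. Halving this block beforehand compensates. -/
theorem blockSnd_skewPart_lowerMatrix {A : Model i (Fin p ⊕ Fin q → ℝ)} (hA : 𝓕.symBlock A = 0) :
    blockSnd 𝓕.frame (skewPart (𝓕.lowerMatrix (A - (1 / 2 : ℝ) • 𝓕.blockIncl (𝓕.block A)))) =
      A := by
  have h : (𝓕.block A).flip = -𝓕.block A := by
    ext1 k; ext1 k'
    have := DFunLike.congr_fun (DFunLike.congr_fun hA k) k'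
    simp only [symBlock_apply, _root_.smul_apply, _root_.add_apply, smul_eq_mul,
      _root_.zero_apply, ContinuousLinearMap.flip_apply] at this
    rw [_root_.neg_apply, _root_.neg_apply, ContinuousLinearMap.flip_apply]
    linarith
  have h' : (𝓕.block (A - (1 / 2 : ℝ) • 𝓕.blockIncl (𝓕.block A))).flip =
      (-(1 / 2) : ℝ) • 𝓕.block A := by
    rw [map_sub, map_smul, block_blockIncl]
    change (𝓕.block A).flip - (1 / 2 : ℝ) • (𝓕.block A).flip = _
    rw [h]
    module
  rw [skewPart_apply, map_sub, blockSnd_lowerMatrix, blockSnd_adjoint_lowerMatrix, h',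
    map_smul]
  module

/-- The projection of the model space to the kernel of `symBlock`, as a map to the kernel. -/
def projKer : Model i (Fin p ⊕ Fin q → ℝ) →L[ℝ] LinearMap.ker 𝓕.symBlock :=
  ContinuousLinearMap.codRestrict
    (LinearMap.toContinuousLinearMap 𝓕.proj : Model i _ →L[ℝ] Model i _)
    (LinearMap.ker 𝓕.symBlock) 𝓕.symBlock_proj

open scoped Matrix.Norms.Operator in
/-- The projections of the slopes of the translates of the centre of the chart under small elements
of `SO(p,q)` fill a neighbourhood of zero, and these translates lie in the given domain. -/
theorem exists_slope_nhds [FiniteDimensional ℝ W] :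
    ∀ᶠ A in nhds (0 : Model i (Fin p ⊕ Fin q → ℝ)), ∃ M : 𝕄, 𝓕.proj (slope 𝓕.frame M) = 𝓕.proj A ∧
      slope 𝓕.frame M ∈ 𝓕.dom ∧ param 𝓕.frame (slope 𝓕.frame M) = expSO M • param 𝓕.frame 0 := by
  let s : 𝕄 →L[ℝ] 𝕄 := LinearMap.toContinuousLinearMap skewPart
  let P : 𝕄 →L[ℝ] ((Fin i → ℝ) →L[ℝ] (Fin i → ℝ)) :=
    LinearMap.toContinuousLinearMap (blockFst 𝓕.frame)
  let R : 𝕄 →L[ℝ] Model i (Fin p ⊕ Fin q → ℝ) :=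
    LinearMap.toContinuousLinearMap (blockSnd 𝓕.frame)
  have h1 : HasStrictFDerivAt (slope 𝓕.frame) (R.comp s) 0 :=
    hasStrictFDerivAt_exp_slope P R (blockFst_one _) (blockSnd_one _) s
  have h4 : Filter.map (fun M => 𝓕.projKer (slope 𝓕.frame M)) (nhds (0 : 𝕄)) =
      -- Surjectivity of the derivative at the single point `M = 0` makes the image of a
      -- neighbourhood of `0` a neighbourhood.
      nhds (𝓕.projKer (slope 𝓕.frame (0 : 𝕄))) := by
    refine map_nhds_eq_of_comp_surj (𝔸 := 𝕄) (E := Model i (Fin p ⊕ Fin q → ℝ)) 𝓕.projKer h1 ?_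
    rintro ⟨A, hA⟩
    refine ⟨𝓕.lowerMatrix (A - (1 / 2 : ℝ) • 𝓕.blockIncl (𝓕.block A)), ?_⟩
    ext1
    change 𝓕.proj (blockSnd 𝓕.frame (skewPart _)) = A
    rw [𝓕.blockSnd_skewPart_lowerMatrix (LinearMap.mem_ker.1 hA), proj_apply,
      LinearMap.mem_ker.1 hA, map_zero, sub_zero]
  have hs0 : slope 𝓕.frame (0 : 𝕄) = 0 := by
    rw [slope, map_zero, NormedSpace.exp_zero, blockSnd_one]
    rfl
  rw [hs0, map_zero] at h4
  have h5 : ∀ᶠ M in nhds (0 : 𝕄), slope 𝓕.frame M ∈ 𝓕.dom := by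
    have : Filter.Tendsto (slope 𝓕.frame) (nhds (0 : 𝕄)) (nhds 0) := by
      have := h1.continuousAt.tendsto
      rwa [hs0] at this
    exact this.eventually (𝓕.isOpen_dom.mem_nhds 𝓕.zero_mem_dom)
  have h6 : ∀ᶠ M in nhds (0 : 𝕄), blockFst 𝓕.frame (NormedSpace.exp (skewPart M)) ∈
      Set.range ((↑) : ((Fin i → ℝ) ≃L[ℝ] (Fin i → ℝ)) → ((Fin i → ℝ) →L[ℝ] (Fin i → ℝ))) := by
    have hc : ContinuousAt (fun M => P (NormedSpace.exp (s M))) 0 := by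
      refine P.continuous.continuousAt.comp (ContinuousAt.comp ?_ s.continuous.continuousAt)
      rw [map_zero]
      exact (hasStrictFDerivAt_exp_zero (𝕂 := ℝ) (𝔸 := 𝕄)).continuousAt
    apply hc.eventually (ContinuousLinearEquiv.isOpen.mem_nhds _)
    refine ⟨ContinuousLinearEquiv.refl ℝ _, ?_⟩
    beta_reduce
    rw [map_zero, NormedSpace.exp_zero]
    exact (blockFst_one 𝓕.frame).symm
  have h7 : (fun M => 𝓕.projKer (slope 𝓕.frame M)) '' {M | slope 𝓕.frame M ∈ 𝓕.dom ∧
      blockFst 𝓕.frame (NormedSpace.exp (skewPart M)) ∈ Set.range ((↑) :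
        ((Fin i → ℝ) ≃L[ℝ] (Fin i → ℝ)) → ((Fin i → ℝ) →L[ℝ] (Fin i → ℝ)))} ∈
      nhds (0 : LinearMap.ker 𝓕.symBlock) := by
    rw [← h4]
    exact Filter.image_mem_map (h5.and h6)
  have h8 : Filter.Tendsto 𝓕.projKer (nhds 0) (nhds 0) := by
    have := 𝓕.projKer.continuous.tendsto 0
    rwa [map_zero] at this
  filter_upwards [h8 h7] with A hA
  obtain ⟨M, ⟨hM1, hM2⟩, hM⟩ := hA
  exact ⟨M, congrArg Subtype.val hM, hM1, param_slope _ _ hM2⟩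

end AdaptedFrame

/-! ### Signatures -/

theorem finrank_ker_add_sigPos_add_sigNeg {E : Type*} [AddCommGroup E] [Module ℝ E]
    [FiniteDimensional ℝ E] (B : SymForm E) :
    sigPos B.1.toQuadraticMap + sigNeg B.1.toQuadraticMap +
      Module.finrank ℝ (LinearMap.ker B.1) = Module.finrank ℝ E := by
  have h := QuadraticForm.sigPos_add_sigNeg_add_radical (Q := B.1.toQuadraticMap)
  rwa [QuadraticMap.radical_eq_ker_associated, QuadraticMap.associated_left_inverse _ B.2] at h

theorem finrank_ker_of_mem_orbitRS {p q i r s : ℕ} {y : Gr i (Fin p ⊕ Fin q → ℝ)}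
    (hy : y ∈ orbitRS p q i r s) :
    Module.finrank ℝ (LinearMap.ker ((form p q).restrict y.carrier)) = i - r - s := by
  have h : _ + _ + Module.finrank ℝ (LinearMap.ker ((form p q).restrict y.carrier)) = _ :=
    finrank_ker_add_sigPos_add_sigNeg (sigma1 y)
  rw [hy.1, hy.2, y.finrank_carrier] at h
  omega

theorem smul_mem_orbitRS {p q i r s : ℕ} {y : Gr i (Fin p ⊕ Fin q → ℝ)}
    (hy : y ∈ orbitRS p q i r s) (A : SO p q) : A • y ∈ orbitRS p q i r s := by
  have h : (sigma1 y).1.toQuadraticMap.Equivalent (sigma1 (A • y)).1.toQuadraticMap :=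
    ⟨{ A.1.toLin'.submoduleMap y.carrier with map_app' := fun v => A.2 v v }⟩
  exact ⟨h.sigPos_eq.symm.trans hy.1, h.sigNeg_eq.symm.trans hy.2⟩

end

end Gr

/-! ### Local coincidence of the zero set, the orbit and the signature stratum. -/

theorem theorem3p3 (p q i r s : ℕ) (hr : r ≤ p) (hs : s ≤ q) (hrs : r + s < i)
    (x : Gr i (Fin p ⊕ Fin q → ℝ)) (hx : x ∈ Gr.orbitRS p q i r s) :
    ∃ (U N : Set (Gr i (Fin p ⊕ Fin q → ℝ)))
      (F : ∀ y : Gr i (Fin p ⊕ Fin q → ℝ), Submodule ℝ (Gr.Fib y)),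
      IsOpen U ∧ x ∈ U ∧
      N = U ∩ Gr.orbitRS p q i r s ∧
      N = U ∩ MulAction.orbit (Gr.SO p q) x ∧
      Gr.IsSmoothSubbundleOn U F (i - r - s) ∧
      (∀ y ∈ U, LinearMap.ker (Gr.sigma1 y).1 ≤ F y) ∧
      Gr.IsDefiningSection U N F (i - r - s) (fun y => Gr.SymForm.restrict (Gr.sigma1 y) (F y)) := by
  obtain ⟨m, l, 𝓕, rfl⟩ := Gr.exists_adaptedFrame Gr.form_nondegenerate (Gr.form_mem p q)
    (i - r - s) x (Gr.finrank_ker_of_mem_orbitRS hx)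
  obtain ⟨O, hO, hOopen, hO0⟩ := eventually_nhds_iff.1 𝓕.exists_slope_nhds
  set U := 𝓕.domGr ∩ ((Gr.chart 𝓕.frame).source ∩ Gr.chart 𝓕.frame ⁻¹' O) with hU
  have hUopen : IsOpen U :=
    𝓕.isOpen_domGr.inter ((Gr.chart 𝓕.frame).isOpen_inter_preimage hOopen)
  have hUdom : U ⊆ 𝓕.domGr := Set.inter_subset_left
  have horbit : MulAction.orbit (Gr.SO p q) (Gr.param 𝓕.frame 0) ⊆ Gr.orbitRS p q i r s := by
    rintro _ ⟨A, rfl⟩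
    exact Gr.smul_mem_orbitRS hx A
  have hzero : ∀ y ∈ 𝓕.domGr, y ∈ Gr.orbitRS p q i r s → 𝓕.schur (Gr.chart 𝓕.frame y) = 0 :=
    fun y hy hy' => 𝓕.schur_eq_zero_of_finrank_ker hy (Gr.finrank_ker_of_mem_orbitRS hy')
  -- The orbit point with coordinate `slope M` and the point `y` are both zeros of `schur` with the
  -- same projection, so they are equal.
  have hmem : ∀ y ∈ U, 𝓕.schur (Gr.chart 𝓕.frame y) = 0 →
      y ∈ MulAction.orbit (Gr.SO p q) (Gr.param 𝓕.frame 0) := by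
    intro y hy hy0
    obtain ⟨M, hM1, hM2, hM3⟩ := hO _ hy.2.2
    have h1 : Gr.param 𝓕.frame (Gr.slope 𝓕.frame M) ∈
        MulAction.orbit (Gr.SO p q) (Gr.param 𝓕.frame 0) := ⟨Gr.expSO M, hM3.symm⟩
    have h2 := hzero _ (𝓕.param_mem_domGr hM2) (horbit h1)
    rw [Gr.chart_param] at h2
    rwa [← Gr.param_chart hy.2.1, ← 𝓕.eq_of_proj_eq h2 hy0 hM1]
  refine ⟨U, {y | y ∈ U ∧ 𝓕.schur (Gr.chart 𝓕.frame y) = 0}, 𝓕.perpBundle, hUopen, ?_, ?_, ?_,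
    𝓕.isSmoothSubbundleOn_perpBundle hUopen hUdom,
    fun y hy => 𝓕.ker_le_perpBundle hy.2.1,
    𝓕.isDefiningSection_perpBundle (Gr.form_mem p q) hUopen hUdom⟩
  · refine ⟨𝓕.param_mem_domGr 𝓕.zero_mem_dom, Gr.param_mem_chart_source _ _, ?_⟩
    rw [Set.mem_preimage, Gr.chart_param]
    exact hO0
  · ext y
    exact ⟨fun hy => ⟨hy.1, horbit (hmem y hy.1 hy.2)⟩,
      fun hy => ⟨hy.1, hzero y (hUdom hy.1) hy.2⟩⟩
  · ext y
    exact ⟨fun hy => ⟨hy.1, hmem y hy.1 hy.2⟩,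
      fun hy => ⟨hy.1, hzero y (hUdom hy.1) (horbit hy.2)⟩⟩
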